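/- **Setting.** Let $h\in\mathbb C$ be such that $q=e^{h}$ is not a root of unity; put $q^{x}=e^{hx}$, $(-1)^x=e^{i\pi x}$ for $x\in\mathbb C$, $[x]=\frac{q^{x}-q^{-x}}{q-q^{-1}}$, $[n]!=[1]\cdots[n]$. For $\lambda\in\mathbb C$ let $M_\lambda$ be the Verma module of $U_q(\mathfrak{sl}_2)$ with basis $e^\lambda_{a}$, $a=\lambda,\lambda-1,\dots$, and action $Ke_a=q^{a}e_a$, $Fe_a=e_{a-1}$, $Ee_a=[\lambda-a][\lambda+a+1]e_{a+1}$ (with $e_{\lambda+1}=0$); on tensor products $\Delta X=X\otimes K+K^{-1}\otimes X$ for $X=E,F$, and $\Delta K=K\otimes K$. Call $\lambda$ *generic* if $[2\lambda+n]\neq0$ for all $n\in\mathbb Z$, and call $(\lambda_1,\lambda_2,\lambda_{12})$ *admissible* if $\lambda_1+\lambda_2-\lambda_{12}\in\mathbb Z_{\ge0}$. For an admissible triple of generic weights, with $n=\lambda_1+\lambda_2-\lambda_{12}$, let $\psi_{\lambda_1,\lambda_2}^{\lambda_{12}}:M_{\lambda_{12}}\to M_{\lambda_1}\otimes M_{\lambda_2}$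 be the embedding of modules that sends $e^{\lambda_{12}}_{\lambda_{12}}$ to the normalised highest weight vector $$\Delta\sum_{k=0}^{n}\frac{(-1)^k q^{k(\lambda_{12}+1)-n(2\lambda_1-n+1)/2}}{[k]!\,[n-k]!\prod_{j<k}[2\lambda_2-j]\prod_{j<n-k}[2\lambda_1-j]}\;e^{\lambda_1}_{\lambda_1-n+k}\otimes e^{\lambda_2}_{\lambda_2-k},\qquad \Delta=\Bigl(\frac{[n]!\prod_{j<n}[2\lambda_1-j][2\lambda_2-j]}{\prod_{j<n}[2\lambda_{12}+2+j]}\Bigr)^{1/2}$$ (principal square root). The $q6j$-symbols are the coefficients in $$\bigl(\psi_{\lambda_1,\lambda_2}^{\lambda_{12}}\otimes \mathrm{id}\bigr)\psi_{\lambda_{12},\lambda_3}^{\lambda}=\sum_{\lambda_{23}}\begin{Bmatrix}\lambda_1&\lambda_2&\lambda_{12}\\ \lambda_3&\lambda&\lambda_{23}\end{Bmatrix}\bigl(\mathrm{id}\otimes\psi_{\lambda_2,\lambda_3}^{\lambda_{23}}\bigr)\psi_{\lambda_1,\lambda_{23}}^{\lambda},$$ where $\lambda_{23}$ runs over $\lambda_2+\lambda_3-k$,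 $0\le k\le\lambda_1+\lambda_2+\lambda_3-\lambda$. The symbol is zero if one of the triples $(\lambda_1,\lambda_2,\lambda_{12})$, $(\lambda_{12},\lambda_3,\lambda)$, $(\lambda_2,\lambda_3,\lambda_{23})$, $(\lambda_1,\lambda_{23},\lambda)$ is not admissible. **Theorem (Yang–Baxter identity).** Let $\lambda_1,\lambda_2,\lambda_3,\lambda_4,\lambda_{23},\lambda_{24},\lambda_{123},\lambda_{124},\lambda_{1234}\in\mathbb C$ be generic, let also $\lambda_1+\lambda_2$ and $\lambda_2+\lambda_3+\lambda_4$ be generic, and let the triples $(\lambda_2,\lambda_3,\lambda_{23})$, $(\lambda_2,\lambda_4,\lambda_{24})$, $(\lambda_1,\lambda_{23},\lambda_{123})$, $(\lambda_1,\lambda_{24},\lambda_{124})$, $(\lambda_4,\lambda_{123},\lambda_{1234})$, $(\lambda_3,\lambda_{124},\lambda_{1234})$ be admissible. Then $$\sum_{\alpha}(-1)^{\lambda_2-\lambda_{23}-\alpha-\lambda_{24}}q^{\lambda_2(\lambda_2+1)-\lambda_{23}(\lambda_{23}+1)-\alpha(\alpha+1)-\lambda_{24}(\lambda_{24}+1)}\begin{Bmatrix}\lambda_1&\lambda_2&\alpha\\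 \lambda_3&\lambda_{123}&\lambda_{23}\end{Bmatrix}\begin{Bmatrix}\lambda_4&\alpha&\lambda_{124}\\ \lambda_3&\lambda_{1234}&\lambda_{123}\end{Bmatrix}\begin{Bmatrix}\lambda_4&\lambda_2&\lambda_{24}\\ \lambda_1&\lambda_{124}&\alpha\end{Bmatrix}$$ $$=\sum_{\beta}(-1)^{\lambda_{1234}-\lambda_{123}-\beta-\lambda_{124}}q^{\lambda_{1234}(\lambda_{1234}+1)-\lambda_{123}(\lambda_{123}+1)-\beta(\beta+1)-\lambda_{124}(\lambda_{124}+1)}\begin{Bmatrix}\lambda_4&\lambda_{23}&\beta\\ \lambda_1&\lambda_{1234}&\lambda_{123}\end{Bmatrix}\begin{Bmatrix}\lambda_4&\lambda_2&\lambda_{24}\\ \lambda_3&\beta&\lambda_{23}\end{Bmatrix}\begin{Bmatrix}\lambda_1&\lambda_{24}&\lambda_{124}\\ \lambda_3&\lambda_{1234}&\beta\end{Bmatrix},$$ where $\alpha=\lambda_1+\lambda_2-j$ with $0\le j\le\min\{\lambda_1+\lambda_2+\lambda_3-\lambda_{123},\ \lambda_1+\lambda_2+\lambda_4-\lambda_{124}\}$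 and $\beta=\lambda_2+\lambda_3+\lambda_4-k$ with $0\le k\le\lambda_1+\lambda_2+\lambda_3+\lambda_4-\lambda_{1234}$. -/

import Mathlib

open scoped TensorProduct

noncomputable section

namespace VermaRacah

/-- The power `q ^ x` with complex exponent, for `q = exp h`. -/
def qpow (h x : ℂ) : ℂ := Complex.exp (h * x)

/-- The `q`-number `[x] = (q ^ x - q ^ (-x)) / (q - q ^ (-1))`. -/
def qnum (h x : ℂ) : ℂ := (qpow h x - qpow h (-x)) / (qpow h 1 - qpow h (-1))

/-- `q = exp h` is not a root of unity. -/
def NotRootOfUnity (h : ℂ) : Prop := ∀ n : ℕ, 0 < n → Complex.exp h ^ n ≠ 1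

/-- A highest weight `l` is generic if `[2 l + n] ≠ 0` for every integer `n`. -/
def IsGeneric (h l : ℂ) : Prop := ∀ n : ℤ, qnum h (2 * l + n) ≠ 0

/-- `(l₁, l₂, l₁₂)` is admissible if `l₁ + l₂ - l₁₂` is a non-negative integer. -/
def Adm (l₁ l₂ l₁₂ : ℂ) : Prop := ∃ n : ℕ, l₁ + l₂ - l₁₂ = n

/-- The non-negative integer `l₁ + l₂ - l₁₂` of an admissible triple. -/
def gap (l₁ l₂ l₁₂ : ℂ) : ℕ := ⌊(l₁ + l₂ - l₁₂).re⌋₊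

/-- `[n]! = [1] [2] ⋯ [n]`. -/
def qfact (h : ℂ) (n : ℕ) : ℂ := ∏ j ∈ Finset.range n, qnum h ((j : ℂ) + 1)

/-- `[x] [x - 1] ⋯ [x - n + 1]`. -/
def qfall (h x : ℂ) (n : ℕ) : ℂ := ∏ j ∈ Finset.range n, qnum h (x - j)

/-- `[x] [x + 1] ⋯ [x + n - 1]`. -/
def qrise (h x : ℂ) (n : ℕ) : ℂ := ∏ j ∈ Finset.range n, qnum h (x + j)

/-- The underlying space of the Verma module `M_l` of highest weight `l`: the basis vector
`Finsupp.single m 1` is the weight vector `e_a` of weight `a = l - m`. -/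
abbrev Verma : Type := ℕ →₀ ℂ

/-- The weight vector `e_{l - m}` of `M_l`. -/
def vec (m : ℕ) : Verma := Finsupp.single m 1

/-- `K e_a = q ^ a e_a` on `M_l`. -/
def opK (h l : ℂ) : Verma →ₗ[ℂ] Verma :=
  Finsupp.linearCombination ℂ fun m : ℕ => qpow h (l - m) • vec m

/-- `K⁻¹ e_a = q ^ (-a) e_a` on `M_l`. -/
def opKinv (h l : ℂ) : Verma →ₗ[ℂ] Verma :=
  Finsupp.linearCombination ℂ fun m : ℕ => qpow h (-(l - m)) • vec m

/-- `E e_a = [l - a] [l + a + 1] e_{a + 1}` on `M_l`. -/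
def opE (h l : ℂ) : Verma →ₗ[ℂ] Verma :=
  Finsupp.linearCombination ℂ fun m : ℕ => (qnum h m * qnum h (2 * l - m + 1)) • vec (m - 1)

/-- `F e_a = e_{a - 1}` on every `M_l`. -/
def opF : Verma →ₗ[ℂ] Verma :=
  Finsupp.linearCombination ℂ fun m : ℕ => vec (m + 1)

/-- The action of `E` on `M_{l₁} ⊗ M_{l₂}`, by the coproduct `Δ E = E ⊗ K + K⁻¹ ⊗ E`. -/
def coE (h l₁ l₂ : ℂ) : Module.End ℂ (Verma ⊗[ℂ] Verma) :=
  TensorProduct.map (opE h l₁) (opK h l₂) + TensorProduct.map (opKinv h l₁) (opE h l₂)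

/-- The action of `F` on `M_{l₁} ⊗ M_{l₂}`, by the coproduct `Δ F = F ⊗ K + K⁻¹ ⊗ F`. -/
def coF (h l₁ l₂ : ℂ) : Module.End ℂ (Verma ⊗[ℂ] Verma) :=
  TensorProduct.map opF (opK h l₂) + TensorProduct.map (opKinv h l₁) opF

/-- The normalising factor of the highest weight vector of weight `l₁₂` in `M_{l₁} ⊗ M_{l₂}`: with
`n = l₁ + l₂ - l₁₂`, the square root of
`[n]! ∏_{j < n} [2 l₁ - j] [2 l₂ - j] / ∏_{j < n} [2 l₁₂ + 2 + j]`. -/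
def Delta (h l₁ l₂ l₁₂ : ℂ) : ℂ :=
  (qfact h (gap l₁ l₂ l₁₂) * (qfall h (2 * l₁) (gap l₁ l₂ l₁₂) * qfall h (2 * l₂) (gap l₁ l₂ l₁₂))
    / qrise h (2 * l₁₂ + 2) (gap l₁ l₂ l₁₂)) ^ (1 / 2 : ℂ)

/-- The coefficient of `e_{l₁ - n + k} ⊗ e_{l₂ - k}` in the highest weight vector of weight
`l₁ + l₂ - n` of `M_{l₁} ⊗ M_{l₂}`, before multiplication by `Delta`. -/
def hwCoeff (h l₁ l₂ : ℂ) (n k : ℕ) : ℂ :=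
  (-1) ^ k * qpow h (k * (l₁ + l₂ - n + 1) - n * (2 * l₁ - n + 1) / 2)
    / (qfact h k * qfact h (n - k) * qfall h (2 * l₂) k * qfall h (2 * l₁) (n - k))

/-- The highest weight vector of weight `l₁₂` in `M_{l₁} ⊗ M_{l₂}`, of length one for the bilinear
form on the tensor product for which the weight vectors are orthogonal, the highest weight vectors
of `M_{l₁}` and `M_{l₂}` have length one, and `E` and `F` are transposes of each other. -/
def hwVec (h l₁ l₂ l₁₂ : ℂ) : Verma ⊗[ℂ] Verma :=
  Delta h l₁ l₂ l₁₂ • ∑ k ∈ Finset.range (gap l₁ l₂ l₁₂ + 1),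
    hwCoeff h l₁ l₂ (gap l₁ l₂ l₁₂) k • (vec (gap l₁ l₂ l₁₂ - k) ⊗ₜ[ℂ] vec k)

theorem qpow_add (h x y : ℂ) : qpow h (x + y) = qpow h x * qpow h y := by
  simp only [qpow, mul_add, Complex.exp_add]

theorem coE_vec_tmul (h l₁ l₂ : ℂ) (i k : ℕ) :
    coE h l₁ l₂ (vec i ⊗ₜ[ℂ] vec k) =
      (qnum h i * qnum h (2 * l₁ - i + 1) * qpow h (l₂ - k)) • (vec (i - 1) ⊗ₜ[ℂ] vec k) +
      (qpow h (-(l₁ - i)) * (qnum h k * qnum h (2 * l₂ - k + 1))) •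
        (vec i ⊗ₜ[ℂ] vec (k - 1)) := by
  simp only [coE, opE, opK, opKinv, vec, LinearMap.add_apply, TensorProduct.map_tmul,
    Finsupp.linearCombination_single, one_smul, TensorProduct.smul_tmul_smul]

theorem qnum_zero (h : ℂ) : qnum h 0 = 0 := by simp [qnum]

theorem NotRootOfUnity.qnum_ne_zero {h : ℂ} (hq : NotRootOfUnity h) (n : ℕ) :
    qnum h ((n : ℂ) + 1) ≠ 0 := by
  have key : ∀ n : ℕ, qpow h ((n : ℂ) + 1) - qpow h (-((n : ℂ) + 1)) ≠ 0 := by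
    intro n hn
    have h1 : qpow h ((n : ℂ) + 1) = qpow h (-((n : ℂ) + 1)) := sub_eq_zero.mp hn
    apply hq (2 * (n + 1)) (by omega)
    have h2 : qpow h ((n : ℂ) + 1) * qpow h ((n : ℂ) + 1) = 1 := by
      nth_rewrite 2 [h1]
      rw [← qpow_add]; simp [qpow]
    rw [← Complex.exp_nat_mul, ← h2, ← qpow_add, qpow]
    congr 1; push_cast; ring
  have := key 0
  simp only [Nat.cast_zero, zero_add] at this
  exact div_ne_zero (key n) this

/-- The vector `hwVec` is a highest weight vector: it is annihilated by `E`. -/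
theorem coE_hwVec {h : ℂ} (hq : NotRootOfUnity h) {l₁ l₂ : ℂ} (g₁ : IsGeneric h l₁)
    (g₂ : IsGeneric h l₂) (l₁₂ : ℂ) : coE h l₁ l₂ (hwVec h l₁ l₂ l₁₂) = 0 := by
  unfold hwVec
  generalize gap l₁ l₂ l₁₂ = n
  rw [map_smul, map_sum]
  simp only [map_smul, coE_vec_tmul, smul_add, smul_smul, Finset.sum_add_distrib]
  rw [Finset.sum_range_succ, Finset.sum_range_succ' (n := n)]
  simp only [Nat.sub_self, Nat.cast_zero, qnum_zero, zero_mul, mul_zero, zero_smul, add_zero]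
  rw [← smul_add, ← Finset.sum_add_distrib, Finset.sum_eq_zero, smul_zero]
  intro k hk
  obtain ⟨m, rfl⟩ : ∃ m, n = k + m + 1 := ⟨n - k - 1, by have := Finset.mem_range.mp hk; omega⟩
  have e1 : k + m + 1 - k = m + 1 := by omega
  have e2 : k + m + 1 - (k + 1) = m := by omega
  simp only [e1, e2, Nat.add_sub_cancel, ← add_smul]
  convert zero_smul ℂ _
  have f1 : ∀ n : ℕ, qfact h n ≠ 0 := fun n => Finset.prod_ne_zero_iff.mpr fun j _ =>
    hq.qnum_ne_zero j
  have f2 : ∀ {l : ℂ}, IsGeneric h l → ∀ n : ℕ, qfall h (2 * l) n ≠ 0 := fun g n =>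
    Finset.prod_ne_zero_iff.mpr fun j _ => by
      have := g (-(j : ℤ))
      push_cast at this
      rwa [← sub_eq_add_neg] at this
  have r1 : qfact h (k + 1) = qfact h k * qnum h ((k : ℂ) + 1) := Finset.prod_range_succ _ _
  have r2 : qfact h (m + 1) = qfact h m * qnum h ((m : ℂ) + 1) := Finset.prod_range_succ _ _
  have r3 : qfall h (2 * l₁) (m + 1) = qfall h (2 * l₁) m * qnum h (2 * l₁ - m) :=
    Finset.prod_range_succ _ _
  have r4 : qfall h (2 * l₂) (k + 1) = qfall h (2 * l₂) k * qnum h (2 * l₂ - k) :=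
    Finset.prod_range_succ _ _
  have n3 := f2 g₁ (m + 1)
  have n4 := f2 g₂ (k + 1)
  rw [r3] at n3
  rw [r4] at n4
  have p1 := hq.qnum_ne_zero k
  have p2 := hq.qnum_ne_zero m
  have p3 := right_ne_zero_of_mul n3
  have p4 := right_ne_zero_of_mul n4
  have p5 := f1 k
  have p6 := f1 m
  have p7 := left_ne_zero_of_mul n3
  have p8 := left_ne_zero_of_mul n4
  unfold hwCoeff
  simp only [e1, e2, r1, r2, r3, r4]
  have q1 : qpow h (((k + 1 : ℕ) : ℂ) * (l₁ + l₂ - ((k + m + 1 : ℕ) : ℂ) + 1) -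
      ((k + m + 1 : ℕ) : ℂ) * (2 * l₁ - ((k + m + 1 : ℕ) : ℂ) + 1) / 2) * qpow h (-(l₁ - m)) =
      qpow h ((k : ℂ) * (l₁ + l₂ - ((k + m + 1 : ℕ) : ℂ) + 1) -
      ((k + m + 1 : ℕ) : ℂ) * (2 * l₁ - ((k + m + 1 : ℕ) : ℂ) + 1) / 2) * qpow h (l₂ - k) := by
    rw [← qpow_add, ← qpow_add]
    congr 1; push_cast; ring
  have s1 : 2 * l₁ - ((m + 1 : ℕ) : ℂ) + 1 = 2 * l₁ - m := by push_cast; ring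
  have s2 : 2 * l₂ - ((k + 1 : ℕ) : ℂ) + 1 = 2 * l₂ - k := by push_cast; ring
  have s3 : ((m + 1 : ℕ) : ℂ) = (m : ℂ) + 1 := by push_cast; ring
  have s4 : ((k + 1 : ℕ) : ℂ) = (k : ℂ) + 1 := by push_cast; ring
  rw [s1, s2, s3, s4]
  rw [s4] at q1
  clear r1 r2 r3 r4 f1 f2 n3 n4
  generalize qnum h ((k : ℂ) + 1) = x₁ at *
  generalize qnum h ((m : ℂ) + 1) = x₂ at *
  generalize qnum h (2 * l₁ - m) = x₃ at *
  generalize qnum h (2 * l₂ - k) = x₄ at *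
  generalize qfall h (2 * l₁) m = x₅ at *
  generalize qfall h (2 * l₂) k = x₆ at *
  generalize qpow h _ = y₁ at *
  generalize qpow h _ = y₂ at *
  generalize qpow h _ = y₃ at *
  generalize qpow h _ = y₄ at *
  field_simp
  linear_combination (-(-1) ^ k) * q1

/-- The embedding `ψ : M_{l₁₂} → M_{l₁} ⊗ M_{l₂}` of modules: it sends the highest weight vector to
`hwVec` and commutes with `F`. Its matrix entries are the `q3j`-symbols. -/
def emb (h l₁ l₂ l₁₂ : ℂ) : Verma →ₗ[ℂ] Verma ⊗[ℂ] Verma :=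
  Finsupp.linearCombination ℂ fun m : ℕ => (coF h l₁ l₂ ^ m) (hwVec h l₁ l₂ l₁₂)

/-- The embedding `M_l → M_{l₁₂} ⊗ M_{l₃} → (M_{l₁} ⊗ M_{l₂}) ⊗ M_{l₃}`, which sends `e_a` to
`e_a^{l₁₂, l}`. -/
def leftEmb (h l₁ l₂ l₁₂ l₃ l : ℂ) : Verma →ₗ[ℂ] Verma ⊗[ℂ] (Verma ⊗[ℂ] Verma) :=
  (TensorProduct.assoc ℂ Verma Verma Verma).toLinearMap ∘ₗ
    TensorProduct.map (emb h l₁ l₂ l₁₂) LinearMap.id ∘ₗ emb h l₁₂ l₃ l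

/-- The embedding `M_l → M_{l₁} ⊗ M_{l₂₃} → M_{l₁} ⊗ (M_{l₂} ⊗ M_{l₃})`, which sends `e_a` to
`e_a^{l₂₃, l}`. -/
def rightEmb (h l₁ l₂ l₃ l l₂₃ : ℂ) : Verma →ₗ[ℂ] Verma ⊗[ℂ] (Verma ⊗[ℂ] Verma) :=
  TensorProduct.map LinearMap.id (emb h l₂ l₃ l₂₃) ∘ₗ emb h l₁ l₂₃ l

/-- `c` is the family of coefficients of `e_a^{l₁₂, l}` with respect to the vectors
`e_a^{l₂₃, l}`, `l₂₃ = l₂ + l₃ - k` with `0 ≤ k ≤ l₁ + l₂ + l₃ - l`, for all `a` at once. -/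
def IsTransition (h l₁ l₂ l₁₂ l₃ l : ℂ) (c : ℕ → ℂ) : Prop :=
  leftEmb h l₁ l₂ l₁₂ l₃ l =
    ∑ k ∈ Finset.range (gap (l₁ + l₂) l₃ l + 1), c k • rightEmb h l₁ l₂ l₃ l (l₂ + l₃ - k)

open Classical in
/-- The `q6j`-symbol `{l₁ l₂ l₁₂; l₃ l l₂₃}`: the coefficient of `e_a^{l₂₃, l}` in `e_a^{l₁₂, l}`
when all four triples are admissible, and zero otherwise. -/
def q6j (h l₁ l₂ l₁₂ l₃ l l₂₃ : ℂ) : ℂ :=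
  if hc : (Adm l₁ l₂ l₁₂ ∧ Adm l₁₂ l₃ l ∧ Adm l₂ l₃ l₂₃ ∧ Adm l₁ l₂₃ l) ∧
      ∃ c : ℕ → ℂ, IsTransition h l₁ l₂ l₁₂ l₃ l c
  then hc.2.choose (gap l₂ l₃ l₂₃) else 0

end VermaRacah

end

open scoped TensorProduct

noncomputable section

namespace VermaRacah

/-! The identity expresses the compatibility of recoupling with braiding. A homomorphism from a
Verma module into a product of two Verma modules is determined by one coordinate of the image of the
highest weight vector (`eq_zero_of_E_eq_zero`). Hence such homomorphisms vanish or are multiples of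
`emb` (`hom_eq_zero`, `hom_eq_smul_emb`), and generic tensor products split into Verma modules
(`exists_isProj`). The `q6j`-symbols are then the components of the left iterated embedding
(`leftEmb_eq_sum`, `IsProj.proj_leftEmb`).

The `R`-matrix gives a braiding `braid` that commutes with the action, acts on each summand by a
scalar `braidPhase` (`braid_emb`), and satisfies one hexagon relation (`hexagon`). Combining the two
with recoupling shows that moving a factor across a coupled pair expands in coupled vectors, with
one `q6j`-symbol and one phase per term (`sum_q6j_braidPhase`).

For the theorem, couple 2 with 4 to 24, then 1 with 24 to 124, then 124 with 3 to 1234, with 1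
standing left of 4. Apply a left inverse of the braiding of 4 past 1 to reach the order 4, 1, 2, 3,
and project 2, 3 onto 23 and then 1, 23 onto 123. What remains is a multiple of the embedding of
1234 into 4 and 123. If the braiding is undone inside 124 before 3 is recoupled, the multiple is the
sum over α (`extract_unmoved`). If 3 is recoupled before the braiding is undone, it is the sum over
β (`extract_moved`). Equating the two gives `sum_q6j_eq`, and a factor common to both sides turns
the phases into the stated ones. -/

/-- Operators `E`, `F`, `K`, `K⁻¹` and `H` on a complex vector space. -/
structure Ops (V : Type) [AddCommMonoid V] [Module ℂ V] where
  E : Module.End ℂ V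
  F : Module.End ℂ V
  K : Module.End ℂ V
  L : Module.End ℂ V
  H : Module.End ℂ V

/-! ### Coproduct, homomorphisms and commutation relations -/

namespace Ops

variable {U V W X : Type} [AddCommMonoid U] [Module ℂ U] [AddCommMonoid V] [Module ℂ V]
  [AddCommMonoid W] [Module ℂ W] [AddCommMonoid X] [Module ℂ X]

/-- The operators on a tensor product, by the coproduct. -/
def tensor (A : Ops V) (B : Ops W) : Ops (V ⊗[ℂ] W) where
  E := TensorProduct.map A.E B.K + TensorProduct.map A.L B.E
  F := TensorProduct.map A.F B.K + TensorProduct.map A.L B.F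
  K := TensorProduct.map A.K B.K
  L := TensorProduct.map A.L B.L
  H := TensorProduct.map A.H LinearMap.id + TensorProduct.map LinearMap.id B.H

/-- A linear map commuting with all five operators. -/
structure IsHom (A : Ops V) (B : Ops W) (f : V →ₗ[ℂ] W) : Prop where
  E : f ∘ₗ A.E = B.E ∘ₗ f
  F : f ∘ₗ A.F = B.F ∘ₗ f
  K : f ∘ₗ A.K = B.K ∘ₗ f
  L : f ∘ₗ A.L = B.L ∘ₗ f
  H : f ∘ₗ A.H = B.H ∘ₗ f

theorem IsHom.id (A : Ops V) : IsHom A A LinearMap.id := ⟨rfl, rfl, rfl, rfl, rfl⟩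

theorem IsHom.comp {A : Ops U} {B : Ops V} {C : Ops W} {g : V →ₗ[ℂ] W} {f : U →ₗ[ℂ] V}
    (hg : IsHom B C g) (hf : IsHom A B f) : IsHom A C (g ∘ₗ f) where
  E := by rw [LinearMap.comp_assoc, hf.E, ← LinearMap.comp_assoc, hg.E, LinearMap.comp_assoc]
  F := by rw [LinearMap.comp_assoc, hf.F, ← LinearMap.comp_assoc, hg.F, LinearMap.comp_assoc]
  K := by rw [LinearMap.comp_assoc, hf.K, ← LinearMap.comp_assoc, hg.K, LinearMap.comp_assoc]
  L := by rw [LinearMap.comp_assoc, hf.L, ← LinearMap.comp_assoc, hg.L, LinearMap.comp_assoc]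
  H := by rw [LinearMap.comp_assoc, hf.H, ← LinearMap.comp_assoc, hg.H, LinearMap.comp_assoc]

theorem IsHom.map {A : Ops U} {B : Ops V} {C : Ops W} {D : Ops X} {f : U →ₗ[ℂ] W}
    {g : V →ₗ[ℂ] X} (hf : IsHom A C f) (hg : IsHom B D g) :
    IsHom (A.tensor B) (C.tensor D) (TensorProduct.map f g) where
  E := by
    simp only [tensor, LinearMap.comp_add, LinearMap.add_comp, ← TensorProduct.map_comp, hf.E,
      hf.L, hg.K, hg.E]
  F := by
    simp only [tensor, LinearMap.comp_add, LinearMap.add_comp, ← TensorProduct.map_comp, hf.F,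
      hf.L, hg.K, hg.F]
  K := by simp only [tensor, ← TensorProduct.map_comp, hf.K, hg.K]
  L := by simp only [tensor, ← TensorProduct.map_comp, hf.L, hg.L]
  H := by
    simp only [tensor, LinearMap.comp_add, LinearMap.add_comp, ← TensorProduct.map_comp, hf.H,
      hg.H, LinearMap.comp_id, LinearMap.id_comp]

/-- This is coassociativity: for either bracketing `E` acts by E⊗K⊗K + K⁻¹⊗E⊗K + K⁻¹⊗K⁻¹⊗E, and `F`
likewise. -/
theorem IsHom.assoc (A : Ops U) (B : Ops V) (C : Ops W) :
    IsHom ((A.tensor B).tensor C) (A.tensor (B.tensor C))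
      (TensorProduct.assoc ℂ U V W).toLinearMap := by
  constructor <;> apply TensorProduct.ext_threefold <;> intro x y z <;>
    simp [tensor, TensorProduct.add_tmul, TensorProduct.tmul_add, add_assoc]

/-- The commutation relations of the quantum group that the theory uses. -/
structure IsRep (h : ℂ) (A : Ops V) : Prop where
  KE : A.K * A.E = qpow h 1 • (A.E * A.K)
  LE : A.L * A.E = qpow h (-1) • (A.E * A.L)
  KF : A.K * A.F = qpow h (-1) • (A.F * A.K)
  LF : A.L * A.F = qpow h 1 • (A.F * A.L)
  HF : A.H * A.F = A.F * A.H + (-1 : ℂ) • A.F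
  KL : A.K * A.L = A.L * A.K
  HK : A.H * A.K = A.K * A.H
  HL : A.H * A.L = A.L * A.H
  EF : A.E * A.F = A.F * A.E + (qpow h 1 - qpow h (-1))⁻¹ • (A.K * A.K) +
    -(qpow h 1 - qpow h (-1))⁻¹ • (A.L * A.L)

end Ops

theorem qpow_zero (h : ℂ) : qpow h 0 = 1 := by simp [qpow]

theorem qpow_ne_zero (h x : ℂ) : qpow h x ≠ 0 := Complex.exp_ne_zero _

theorem qpow_neg (h x : ℂ) : qpow h (-x) = (qpow h x)⁻¹ := by
  simp [qpow, Complex.exp_neg]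

/-- In the relation for `E` and `F` the mixed terms cancel, because the powers of q from moving `L`
past `E` or `F` match those from moving `K` past the other. The diagonal terms telescope from
(K²-L²)⊗K² + L²⊗(K²-L²) to K²⊗K² - L²⊗L². That `K` and `L` are inverse is never needed, only that
they commute. -/
theorem Ops.IsRep.tensor {V W : Type} [AddCommMonoid V] [Module ℂ V] [AddCommMonoid W] [Module ℂ W]
    {h : ℂ} {A : Ops V} {B : Ops W} (hA : A.IsRep h) (hB : B.IsRep h) :
    (A.tensor B).IsRep h := by
  constructor
  · simp only [Ops.tensor, mul_add, add_mul, ← TensorProduct.map_mul, hA.KE, hB.KE, hA.KL,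
      TensorProduct.map_smul_left, TensorProduct.map_smul_right, smul_add]
  · simp only [Ops.tensor, mul_add, add_mul, ← TensorProduct.map_mul, hA.LE, hB.LE, hB.KL,
      TensorProduct.map_smul_left, TensorProduct.map_smul_right, smul_add]
  · simp only [Ops.tensor, mul_add, add_mul, ← TensorProduct.map_mul, hA.KF, hB.KF, hA.KL,
      TensorProduct.map_smul_left, TensorProduct.map_smul_right, smul_add]
  · simp only [Ops.tensor, mul_add, add_mul, ← TensorProduct.map_mul, hA.LF, hB.LF, hB.KL,
      TensorProduct.map_smul_left, TensorProduct.map_smul_right, smul_add]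
  · simp only [Ops.tensor, mul_add, add_mul, ← TensorProduct.map_mul, ← Module.End.one_eq_id,
      one_mul, mul_one, hA.HF, hB.HF, hA.HL, hB.HK,
      TensorProduct.map_smul_left, TensorProduct.map_smul_right, TensorProduct.map_add_left,
      TensorProduct.map_add_right]
    module
  · simp only [Ops.tensor, ← TensorProduct.map_mul, hA.KL, hB.KL]
  · simp only [Ops.tensor, mul_add, add_mul, ← TensorProduct.map_mul, ← Module.End.one_eq_id,
      one_mul, mul_one, hA.HK, hB.HK]
  · simp only [Ops.tensor, mul_add, add_mul, ← TensorProduct.map_mul, ← Module.End.one_eq_id,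
      one_mul, mul_one, hA.HL, hB.HL]
  · simp only [Ops.tensor, mul_add, add_mul, ← TensorProduct.map_mul, hA.EF, hB.EF, hA.LF, hB.KF,
      hA.LE, hB.KE,
      TensorProduct.map_smul_left, TensorProduct.map_smul_right, TensorProduct.map_add_left,
      TensorProduct.map_add_right]
    module

/-! ### Verma modules as representations -/

/-- The operator `H e_a = a e_a` on `M_l`. -/
def opH (l : ℂ) : Verma →ₗ[ℂ] Verma :=
  Finsupp.linearCombination ℂ fun m : ℕ => (l - m) • vec m

/-- The Verma module `M_l`. -/
def verma (h l : ℂ) : Ops Verma := ⟨opE h l, opF, opK h l, opKinv h l, opH l⟩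

/-- The tensor product `M_a ⊗ M_b`. -/
abbrev verma₂ (h a b : ℂ) : Ops (Verma ⊗[ℂ] Verma) := (verma h a).tensor (verma h b)

section

variable {M : Type} [AddCommMonoid M] [Module ℂ M]

theorem verma_ext {f g : Verma →ₗ[ℂ] M} (hfg : ∀ m, f (vec m) = g (vec m)) : f = g :=
  Finsupp.lhom_ext' fun m => LinearMap.ext_ring (hfg m)

theorem verma₂_ext {f g : Verma ⊗[ℂ] Verma →ₗ[ℂ] M}
    (hfg : ∀ i j, f (vec i ⊗ₜ vec j) = g (vec i ⊗ₜ vec j)) : f = g :=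
  TensorProduct.ext (verma_ext fun i => verma_ext fun j => hfg i j)

theorem verma_lin (f : ℕ → M) (m : ℕ) : Finsupp.linearCombination ℂ f (vec m) = f m := by
  simp [vec]

end

theorem opE_vec (h l : ℂ) (m : ℕ) :
    opE h l (vec m) = (qnum h m * qnum h (2 * l - m + 1)) • vec (m - 1) := verma_lin _ _

theorem opF_vec (m : ℕ) : opF (vec m) = vec (m + 1) := verma_lin _ _

theorem opK_vec (h l : ℂ) (m : ℕ) : opK h l (vec m) = qpow h (l - m) • vec m := verma_lin _ _

theorem opKinv_vec (h l : ℂ) (m : ℕ) : opKinv h l (vec m) = qpow h (-(l - m)) • vec m :=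
  verma_lin _ _

theorem opH_vec (l : ℂ) (m : ℕ) : opH l (vec m) = (l - m) • vec m := verma_lin _ _

theorem qnum_mul_sub (h x y z w u : ℂ) (e₁ : z = x + 1) (e₂ : w = y - 1) (e₃ : u = y - x - 1) :
    qnum h z * qnum h w = qnum h x * qnum h y + qnum h u := by
  subst e₁ e₂ e₃
  simp only [qnum, sub_eq_add_neg, qpow_add, qpow_neg, neg_add, neg_neg]
  have := qpow_ne_zero h x
  have := qpow_ne_zero h y
  have := qpow_ne_zero h 1
  generalize qpow h x = a at *
  generalize qpow h y = b at *
  generalize qpow h 1 = c at *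
  by_cases hc : c + -c⁻¹ = 0
  · simp [hc]
  · field_simp
    ring

/-- The relation between `E` and `F` on one weight vector: the matrix coefficients of EF and FE
differ by [2(l - m)]. -/
theorem qnum_succ_mul (h l : ℂ) (m : ℕ) :
    qnum h (m + 1 : ℕ) * qnum h (2 * l - (m + 1 : ℕ) + 1) = qnum h m * qnum h (2 * l - m + 1) +
      (qpow h 1 - qpow h (-1))⁻¹ * qpow h (l - m + (l - m)) +
      -(qpow h 1 - qpow h (-1))⁻¹ * qpow h (-(l - m) + -(l - m)) := by
  rw [qnum_mul_sub h m (2 * l - m + 1) _ _ (2 * l - 2 * m) (by push_cast; ring)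
    (by push_cast; ring) (by ring), add_assoc]
  congr 1
  rw [qnum, show l - (m : ℂ) + (l - m) = 2 * l - 2 * m by ring,
    show -(l - (m : ℂ)) + -(l - m) = -(2 * l - 2 * m) by ring]
  ring

theorem verma_isRep (h l : ℂ) : (verma h l).IsRep h := by
  constructor <;> refine verma_ext fun m => ?_ <;>
    simp only [verma, Module.End.mul_apply, LinearMap.add_apply,
      LinearMap.smul_apply, opE_vec, opF_vec, opK_vec, opKinv_vec, opH_vec, map_smul, smul_smul]
  · rcases m with - | m
    · simp [qnum_zero]
    · congr 1
      rw [show (l - ((m + 1 - 1 : ℕ) : ℂ)) = l - (m + 1 : ℕ) + 1 by push_cast; ring, qpow_add]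
      ring
  · rcases m with - | m
    · simp [qnum_zero]
    · congr 1
      rw [show -(l - ((m + 1 - 1 : ℕ) : ℂ)) = -(l - (m + 1 : ℕ)) + -1 by push_cast; ring,
        qpow_add]
      ring
  · congr 1
    rw [← qpow_add]; congr 1; push_cast; ring
  · congr 1
    rw [← qpow_add]; congr 1; push_cast; ring
  · push_cast; module
  · rw [mul_comm]
  · rw [mul_comm]
  · rw [mul_comm]
  · rw [← qpow_add, ← qpow_add, Nat.add_sub_cancel]
    simp only [qnum_succ_mul, add_smul]
    congr 2
    rcases m with - | m
    · simp [qnum_zero]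
    · rfl

theorem verma₂_isRep (h a b : ℂ) : (verma₂ h a b).IsRep h :=
  (verma_isRep h a).tensor (verma_isRep h b)

/-! ### Highest weight vectors and the homomorphisms they generate -/

theorem coE_eq (h a b : ℂ) : coE h a b = (verma₂ h a b).E := rfl

theorem gap_eq {l₁ l₂ l₁₂ : ℂ} {n : ℕ} (hn : l₁ + l₂ - l₁₂ = n) : gap l₁ l₂ l₁₂ = n := by
  simp [gap, hn]

theorem hwVec_eq (h : ℂ) {l₁ l₂ l₁₂ : ℂ} {n : ℕ} (hn : l₁ + l₂ - l₁₂ = n) :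
    hwVec h l₁ l₂ l₁₂ = Delta h l₁ l₂ l₁₂ • ∑ k ∈ Finset.range (n + 1),
      hwCoeff h l₁ l₂ n k • (vec (n - k) ⊗ₜ[ℂ] vec k) := by
  rw [hwVec, gap_eq hn]

/-- A vector of `M` with the properties of the highest weight vector of `M_l`. -/
structure Ops.IsHighest {M : Type} [AddCommMonoid M] [Module ℂ M] (A : Ops M) (h l : ℂ) (x : M) :
    Prop where
  E : A.E x = 0
  K : A.K x = qpow h l • x
  L : A.L x = qpow h (-l) • x
  H : A.H x = l • x

/-- All terms of `hwVec` have total weight `l₁₂`, so an operator that is scalar on that weight space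
is scalar on the sum. -/
theorem map_hwVec {h l₁ l₂ l₁₂ : ℂ} {n : ℕ} (hn : l₁ + l₂ - l₁₂ = n)
    {f : Module.End ℂ (Verma ⊗[ℂ] Verma)} {c : ℂ}
    (hf : ∀ i j : ℕ, l₁ - i + (l₂ - j) = l₁₂ → f (vec i ⊗ₜ vec j) = c • (vec i ⊗ₜ vec j)) :
    f (hwVec h l₁ l₂ l₁₂) = c • hwVec h l₁ l₂ l₁₂ := by
  rw [hwVec_eq h hn, map_smul, smul_comm c, map_sum, Finset.smul_sum (r := c)]
  congr 1
  refine Finset.sum_congr rfl fun k hk => ?_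
  rw [map_smul, smul_comm c, hf]
  rw [Nat.cast_sub (by have := Finset.mem_range.mp hk; omega)]
  linear_combination hn

theorem hwVec_isHighest {h : ℂ} (hq : NotRootOfUnity h) {l₁ l₂ l₁₂ : ℂ} (g₁ : IsGeneric h l₁)
    (g₂ : IsGeneric h l₂) (ha : Adm l₁ l₂ l₁₂) :
    (verma₂ h l₁ l₂).IsHighest h l₁₂ (hwVec h l₁ l₂ l₁₂) := by
  obtain ⟨n, hn⟩ := ha
  refine ⟨coE_hwVec hq g₁ g₂ l₁₂, map_hwVec hn ?_, map_hwVec hn ?_, map_hwVec hn ?_⟩ <;>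
    rintro i j rfl
  · simp only [Ops.tensor, verma, TensorProduct.map_tmul, opK_vec, TensorProduct.smul_tmul_smul,
      ← qpow_add]
  · simp only [Ops.tensor, verma, TensorProduct.map_tmul, opKinv_vec,
      TensorProduct.smul_tmul_smul, ← qpow_add, neg_add]
  · simp only [Ops.tensor, verma, LinearMap.add_apply, TensorProduct.map_tmul, opH_vec,
      LinearMap.id_apply, ← TensorProduct.smul_tmul', TensorProduct.tmul_smul, ← add_smul]

/-- The linear map `M_l → M` that sends `e_{l - m}` to `F ^ m x`. -/
def Ops.gen {M : Type} [AddCommMonoid M] [Module ℂ M] (A : Ops M) (x : M) : Verma →ₗ[ℂ] M :=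
  Finsupp.linearCombination ℂ fun m : ℕ => (A.F ^ m) x

/-- The universal property of Verma modules: the commutation relations alone fix the action on F^m
x, by induction on m. -/
theorem Ops.IsHighest.isHom_gen {M : Type} [AddCommMonoid M] [Module ℂ M] {A : Ops M} {h l : ℂ}
    {x : M} (hA : A.IsRep h) (hx : A.IsHighest h l x) : (verma h l).IsHom A (A.gen x) := by
  have hK : ∀ m : ℕ, A.K ((A.F ^ m) x) = qpow h (l - m) • (A.F ^ m) x := by
    intro m
    induction m with
    | zero => simp [hx.K]
    | succ m ih =>
      have := LinearMap.congr_fun hA.KF ((A.F ^ m) x)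
      simp only [Module.End.mul_apply, LinearMap.smul_apply] at this
      rw [pow_succ', Module.End.mul_apply, this, ih, map_smul, smul_smul, ← qpow_add]
      congr 2; push_cast; ring
  have hL : ∀ m : ℕ, A.L ((A.F ^ m) x) = qpow h (-(l - m)) • (A.F ^ m) x := by
    intro m
    induction m with
    | zero => simp [hx.L]
    | succ m ih =>
      have := LinearMap.congr_fun hA.LF ((A.F ^ m) x)
      simp only [Module.End.mul_apply, LinearMap.smul_apply] at this
      rw [pow_succ', Module.End.mul_apply, this, ih, map_smul, smul_smul, ← qpow_add]
      congr 2; push_cast; ring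
  have hE : ∀ m : ℕ, A.E ((A.F ^ m) x) =
      (qnum h m * qnum h (2 * l - m + 1)) • (A.F ^ (m - 1)) x := by
    intro m
    induction m with
    | zero => simp [hx.E, qnum_zero]
    | succ m ih =>
      have := LinearMap.congr_fun hA.EF ((A.F ^ m) x)
      simp only [Module.End.mul_apply, LinearMap.smul_apply, LinearMap.add_apply] at this
      rw [pow_succ', Module.End.mul_apply, this, ih, hK, hL, map_smul, map_smul, map_smul, hK, hL]
      simp only [smul_smul, ← qpow_add, Nat.add_sub_cancel]
      simp only [qnum_succ_mul, add_smul]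
      congr 2
      rcases m with - | m
      · simp [qnum_zero]
      · rw [Nat.add_sub_cancel, pow_succ', Module.End.mul_apply]
  constructor <;> refine verma_ext fun m => ?_ <;>
    simp only [LinearMap.comp_apply, verma, opE_vec, opF_vec, opK_vec, opKinv_vec, opH_vec,
      map_smul, Ops.gen, verma_lin, hE, hK, hL]
  · rw [pow_succ', Module.End.mul_apply]
  · induction m with
    | zero => simp [hx.H]
    | succ m ih =>
      have := LinearMap.congr_fun hA.HF ((A.F ^ m) x)
      simp only [Module.End.mul_apply, LinearMap.smul_apply, LinearMap.add_apply] at this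
      rw [pow_succ', Module.End.mul_apply, this, ← ih, map_smul]
      push_cast; module

theorem emb_isHom {h : ℂ} (hq : NotRootOfUnity h) {l₁ l₂ l₁₂ : ℂ} (g₁ : IsGeneric h l₁)
    (g₂ : IsGeneric h l₂) (ha : Adm l₁ l₂ l₁₂) :
    (verma h l₁₂).IsHom (verma₂ h l₁ l₂) (emb h l₁ l₂ l₁₂) :=
  (hwVec_isHighest hq g₁ g₂ ha).isHom_gen (verma₂_isRep h l₁ l₂)

theorem emb_vec (h l₁ l₂ l₁₂ : ℂ) (m : ℕ) :
    emb h l₁ l₂ l₁₂ (vec m) = (coF h l₁ l₂ ^ m) (hwVec h l₁ l₂ l₁₂) := by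
  rw [emb, verma_lin]

theorem emb_vec_zero (h l₁ l₂ l₁₂ : ℂ) : emb h l₁ l₂ l₁₂ (vec 0) = hwVec h l₁ l₂ l₁₂ := by
  rw [emb_vec, pow_zero, Module.End.one_apply]

/-- The tensor product `M_a ⊗ (M_b ⊗ M_c)`. -/
abbrev verma₃ (h a b c : ℂ) : Ops (Verma ⊗[ℂ] (Verma ⊗[ℂ] Verma)) :=
  (verma h a).tensor (verma₂ h b c)

theorem leftEmb_isHom {h : ℂ} (hq : NotRootOfUnity h) {l₁ l₂ l₁₂ l₃ l : ℂ} (g₁ : IsGeneric h l₁)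
    (g₂ : IsGeneric h l₂) (g₃ : IsGeneric h l₃) (g₁₂ : IsGeneric h l₁₂) (ha : Adm l₁ l₂ l₁₂)
    (hb : Adm l₁₂ l₃ l) : (verma h l).IsHom (verma₃ h l₁ l₂ l₃) (leftEmb h l₁ l₂ l₁₂ l₃ l) := by
  have h1 := emb_isHom hq g₁₂ g₃ hb
  have h2 := (emb_isHom hq g₁ g₂ ha).map (Ops.IsHom.id (verma h l₃))
  exact (Ops.IsHom.assoc (verma h l₁) (verma h l₂) (verma h l₃)).comp (h2.comp h1)

theorem rightEmb_isHom {h : ℂ} (hq : NotRootOfUnity h) {l₁ l₂ l₂₃ l₃ l : ℂ} (g₁ : IsGeneric h l₁)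
    (g₂ : IsGeneric h l₂) (g₃ : IsGeneric h l₃) (g₂₃ : IsGeneric h l₂₃) (ha : Adm l₂ l₃ l₂₃)
    (hb : Adm l₁ l₂₃ l) : (verma h l).IsHom (verma₃ h l₁ l₂ l₃) (rightEmb h l₁ l₂ l₃ l l₂₃) := by
  have h1 := emb_isHom hq g₁ g₂₃ hb
  have h2 := (Ops.IsHom.id (verma h l₁)).map (emb_isHom hq g₂ g₃ ha)
  exact h2.comp h1

/-- Linear maps from `M_l` commuting with `F` agree if they agree on the highest weight vector. -/
theorem verma_ext_of_comm {M : Type} [AddCommMonoid M] [Module ℂ M] {T : M →ₗ[ℂ] M}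
    {f g : Verma →ₗ[ℂ] M} (hf : f ∘ₗ opF = T ∘ₗ f) (hg : g ∘ₗ opF = T ∘ₗ g)
    (h₀ : f (vec 0) = g (vec 0)) : f = g := by
  refine verma_ext fun m => ?_
  induction m with
  | zero => exact h₀
  | succ m ih =>
    have h1 := LinearMap.congr_fun hf (vec m)
    have h2 := LinearMap.congr_fun hg (vec m)
    simp only [LinearMap.comp_apply, opF_vec] at h1 h2
    rw [h1, h2, ih]

theorem IsGeneric.sub_natCast {h l : ℂ} (g : IsGeneric h l) (n : ℕ) : IsGeneric h (l - n) :=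
  fun m => by
    have := g (m - 2 * n)
    push_cast at this
    convert this using 2
    ring

theorem IsGeneric.of_sub_natCast {h l l' : ℂ} (g : IsGeneric h l) {n : ℕ} (e : l' - l = n) :
    IsGeneric h l' :=
  fun m => by
    have := g (m + 2 * n)
    push_cast at this
    convert this using 2
    linear_combination 2 * e

theorem IsGeneric.qnum_ne_zero {h l : ℂ} (g : IsGeneric h l) (n : ℤ) {x : ℂ} (e : x = 2 * l + n) :
    qnum h x ≠ 0 := e ▸ g n

theorem IsGeneric.qfall_ne_zero {h l : ℂ} (g : IsGeneric h l) (n : ℕ) : qfall h (2 * l) n ≠ 0 :=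
  Finset.prod_ne_zero_iff.mpr fun j _ => g.qnum_ne_zero (-j) (by push_cast; ring)

theorem NotRootOfUnity.qfact_ne_zero {h : ℂ} (hq : NotRootOfUnity h) (n : ℕ) : qfact h n ≠ 0 :=
  Finset.prod_ne_zero_iff.mpr fun j _ => hq.qnum_ne_zero j

/-! ### Coordinates, and vectors annihilated by `E` -/

/-- The coefficient of `vec i ⊗ vec j`. -/
def coord (i j : ℕ) : Verma ⊗[ℂ] Verma →ₗ[ℂ] ℂ :=
  Finsupp.lapply (i, j) ∘ₗ (finsuppTensorFinsupp' ℂ ℕ ℕ).toLinearMap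

theorem coord_vec (i j a b : ℕ) :
    coord i j (vec a ⊗ₜ vec b) = if a = i ∧ b = j then 1 else 0 := by
  simp [coord, vec, Finsupp.single_apply]

theorem eq_of_coord {x y : Verma ⊗[ℂ] Verma} (hxy : ∀ i j, coord i j x = coord i j y) : x = y :=
  (finsuppTensorFinsupp' ℂ ℕ ℕ).injective (Finsupp.ext fun ⟨i, j⟩ => hxy i j)

theorem coord_H (h l₁ l₂ : ℂ) (i j : ℕ) (x : Verma ⊗[ℂ] Verma) :
    coord i j ((verma₂ h l₁ l₂).H x) = (l₁ - i + (l₂ - j)) * coord i j x := by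
  suffices e : coord i j ∘ₗ (verma₂ h l₁ l₂).H = (l₁ - i + (l₂ - j)) • coord i j from
    LinearMap.congr_fun e x
  refine verma₂_ext fun a b => ?_
  simp only [Ops.tensor, verma, LinearMap.comp_apply, LinearMap.smul_apply, LinearMap.add_apply,
    TensorProduct.map_tmul, opH_vec, LinearMap.id_apply, ← TensorProduct.smul_tmul',
    TensorProduct.tmul_smul, map_add, map_smul, coord_vec]
  split_ifs with hab
  · obtain ⟨rfl, rfl⟩ := hab
    simp
  · simp

theorem coord_E (h l₁ l₂ : ℂ) (i j : ℕ) (x : Verma ⊗[ℂ] Verma) :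
    coord i j ((verma₂ h l₁ l₂).E x) =
      qnum h (i + 1 : ℕ) * qnum h (2 * l₁ - (i + 1 : ℕ) + 1) * qpow h (l₂ - j) *
        coord (i + 1) j x +
      qpow h (-(l₁ - i)) * (qnum h (j + 1 : ℕ) * qnum h (2 * l₂ - (j + 1 : ℕ) + 1)) *
        coord i (j + 1) x := by
  suffices e : coord i j ∘ₗ (verma₂ h l₁ l₂).E =
      (qnum h (i + 1 : ℕ) * qnum h (2 * l₁ - (i + 1 : ℕ) + 1) * qpow h (l₂ - j)) •
        coord (i + 1) j +
      (qpow h (-(l₁ - i)) * (qnum h (j + 1 : ℕ) * qnum h (2 * l₂ - (j + 1 : ℕ) + 1))) •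
        coord i (j + 1) from
    LinearMap.congr_fun e x
  refine verma₂_ext fun a b => ?_
  rw [LinearMap.comp_apply, ← coE_eq, coE_vec_tmul]
  simp only [LinearMap.smul_apply, LinearMap.add_apply, map_add, map_smul, coord_vec, smul_eq_mul]
  congr 1
  · rcases a with - | a
    · simp [qnum_zero]
    · simp only [Nat.add_sub_cancel, add_left_inj]
      split_ifs with hab
      · obtain ⟨rfl, rfl⟩ := hab
        rfl
      · simp
  · rcases b with - | b
    · simp [qnum_zero]
    · simp only [Nat.add_sub_cancel, add_left_inj]
      split_ifs with hab
      · obtain ⟨rfl, rfl⟩ := hab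
        rfl
      · simp

/-- The coordinate of Ex at (i, j) combines those of x at (i+1, j) and (i, j+1), the latter with a
nonzero factor. So column j determines column j+1, and column 0 determines x. -/
theorem eq_zero_of_E_eq_zero {h : ℂ} (hq : NotRootOfUnity h) {l₁ l₂ : ℂ} (g₂ : IsGeneric h l₂)
    {x : Verma ⊗[ℂ] Verma} (hx : (verma₂ h l₁ l₂).E x = 0) (h₀ : ∀ i, coord i 0 x = 0) :
    x = 0 := by
  refine eq_of_coord fun i j => ?_
  rw [map_zero]
  induction j generalizing i with
  | zero => exact h₀ i
  | succ j ih =>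
    have := coord_E h l₁ l₂ i j x
    rw [hx, map_zero, ih, mul_zero, zero_add, eq_comm, mul_eq_zero] at this
    refine this.resolve_left (mul_ne_zero (qpow_ne_zero _ _) (mul_ne_zero ?_ ?_))
    · push_cast
      exact hq.qnum_ne_zero j
    · exact g₂.qnum_ne_zero (-j) (by push_cast; ring)

theorem coord_hwVec (h : ℂ) {l₁ l₂ l₁₂ : ℂ} {n : ℕ} (hn : l₁ + l₂ - l₁₂ = n) (i j : ℕ) :
    coord i j (hwVec h l₁ l₂ l₁₂) =
      if i + j = n then Delta h l₁ l₂ l₁₂ * hwCoeff h l₁ l₂ n j else 0 := by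
  rw [hwVec_eq h hn, map_smul, map_sum]
  simp only [map_smul, coord_vec, smul_eq_mul, mul_ite, mul_one, mul_zero]
  split_ifs with hij
  · rw [Finset.sum_eq_single j]
    · rw [if_pos (by omega)]
    · intro k hk hkj
      rw [if_neg (by omega)]
    · intro hj
      simp only [Finset.mem_range] at hj
      omega
  · rw [Finset.sum_eq_zero, mul_zero]
    intro k hk
    rw [if_neg (by simp only [Finset.mem_range] at hk; omega)]

theorem Delta_ne_zero {h : ℂ} (hq : NotRootOfUnity h) {l₁ l₂ l₁₂ : ℂ} (g₁ : IsGeneric h l₁)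
    (g₂ : IsGeneric h l₂) (g₁₂ : IsGeneric h l₁₂) : Delta h l₁ l₂ l₁₂ ≠ 0 := by
  rw [Delta, Ne, Complex.cpow_eq_zero_iff, not_and_or]
  refine Or.inl (div_ne_zero (mul_ne_zero (hq.qfact_ne_zero _)
    (mul_ne_zero (g₁.qfall_ne_zero _) (g₂.qfall_ne_zero _))) ?_)
  exact Finset.prod_ne_zero_iff.mpr fun j _ => g₁₂.qnum_ne_zero (2 + j) (by push_cast; ring)

theorem hwCoeff_ne_zero {h : ℂ} (hq : NotRootOfUnity h) {l₁ l₂ : ℂ} (g₁ : IsGeneric h l₁)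
    (g₂ : IsGeneric h l₂) (n k : ℕ) : hwCoeff h l₁ l₂ n k ≠ 0 :=
  div_ne_zero (mul_ne_zero (pow_ne_zero _ (by norm_num)) (qpow_ne_zero _ _))
    (mul_ne_zero (mul_ne_zero (mul_ne_zero (hq.qfact_ne_zero _) (hq.qfact_ne_zero _))
      (g₂.qfall_ne_zero _)) (g₁.qfall_ne_zero _))

/-- This is the purpose of `H`: it detects the weight itself, whereas `K` only sees its q-power,
which does not determine a complex number. -/
theorem coord_eq_zero_of_H {h l₁ l₂ l : ℂ} {x : Verma ⊗[ℂ] Verma}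
    (hx : (verma₂ h l₁ l₂).H x = l • x) {i j : ℕ} (hij : l₁ - i + (l₂ - j) ≠ l) :
    coord i j x = 0 := by
  have := coord_H h l₁ l₂ i j x
  rw [hx, map_smul, smul_eq_mul, ← sub_eq_zero, ← sub_mul, mul_eq_zero, sub_eq_zero] at this
  exact this.resolve_left hij.symm

/-! ### Homomorphisms from a Verma module to a tensor product -/

section Schur

variable {h : ℂ} {l₁ l₂ l : ℂ} {φ : Verma →ₗ[ℂ] Verma ⊗[ℂ] Verma}

theorem Ops.IsHom.E_vec_zero {M : Type} [AddCommMonoid M] [Module ℂ M] {A : Ops M}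
    {φ : Verma →ₗ[ℂ] M} (hφ : (verma h l).IsHom A φ) : A.E (φ (vec 0)) = 0 := by
  have := LinearMap.congr_fun hφ.E (vec 0)
  simp only [LinearMap.comp_apply, verma, opE_vec, Nat.cast_zero, qnum_zero, zero_mul, zero_smul,
    map_zero] at this
  exact this.symm

theorem Ops.IsHom.H_vec {M : Type} [AddCommMonoid M] [Module ℂ M] {A : Ops M}
    {φ : Verma →ₗ[ℂ] M} (hφ : (verma h l).IsHom A φ) (m : ℕ) :
    A.H (φ (vec m)) = (l - m) • φ (vec m) := by
  have := LinearMap.congr_fun hφ.H (vec m)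
  simp only [LinearMap.comp_apply, verma, opH_vec, map_smul] at this
  exact this.symm

/-- The coordinates (i, 0) have weights l₁ + l₂ - i, none of which is l, so the image of the highest
weight vector vanishes in column 0 and hence everywhere. -/
theorem hom_eq_zero (hq : NotRootOfUnity h) (g₂ : IsGeneric h l₂)
    (hφ : (verma h l).IsHom (verma₂ h l₁ l₂) φ) (ha : ¬ Adm l₁ l₂ l) : φ = 0 := by
  refine verma_ext_of_comm hφ.F (by simp) ?_
  refine eq_zero_of_E_eq_zero hq g₂ hφ.E_vec_zero fun i => ?_
  refine coord_eq_zero_of_H (l := l) (by simpa using hφ.H_vec 0) fun e => ha ⟨i, ?_⟩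
  rw [← e]; push_cast; ring

/-- For weight reasons only the coordinate (n, 0) survives in column 0. It is nonzero on `hwVec`, so
the constant is the ratio of the two coordinates. -/
theorem hom_eq_smul_emb (hq : NotRootOfUnity h) (g₁ : IsGeneric h l₁) (g₂ : IsGeneric h l₂)
    (g : IsGeneric h l) (hφ : (verma h l).IsHom (verma₂ h l₁ l₂) φ) {n : ℕ}
    (hn : l₁ + l₂ - l = n) :
    φ = (coord n 0 (φ (vec 0)) / (Delta h l₁ l₂ l * hwCoeff h l₁ l₂ n 0)) • emb h l₁ l₂ l := by
  have he := emb_isHom hq g₁ g₂ ⟨n, hn⟩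
  have h0 := mul_ne_zero (Delta_ne_zero hq g₁ g₂ g) (hwCoeff_ne_zero hq g₁ g₂ n 0)
  set c := coord n 0 (φ (vec 0)) / (Delta h l₁ l₂ l * hwCoeff h l₁ l₂ n 0) with hc
  have he' : (verma₂ h l₁ l₂).E (emb h l₁ l₂ l (vec 0)) = 0 := he.E_vec_zero
  refine verma_ext_of_comm hφ.F (T := (verma₂ h l₁ l₂).F) ?_ ?_
  · have : emb h l₁ l₂ l ∘ₗ opF = _ := he.F
    rw [LinearMap.smul_comp, this, LinearMap.comp_smul]
  · rw [← sub_eq_zero]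
    refine eq_zero_of_E_eq_zero hq g₂ (l₁ := l₁) ?_ fun i => ?_
    · rw [map_sub, hφ.E_vec_zero, LinearMap.smul_apply, map_smul, he', smul_zero]; exact sub_self _
    · rw [map_sub, LinearMap.smul_apply, map_smul, emb_vec_zero, coord_hwVec h hn]
      split_ifs with hi
      · obtain rfl : i = n := hi
        rw [hc, smul_eq_mul, div_mul_cancel₀ _ h0, sub_self]
      · rw [smul_zero, sub_zero]
        refine coord_eq_zero_of_H (l := l) (by simpa using hφ.H_vec 0) fun e => hi ?_
        have : (n : ℂ) = (i + 0 : ℕ) := by rw [← hn, ← e]; push_cast; ring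
        exact_mod_cast this.symm

end Schur

/-! ### Decomposition of a tensor product into Verma modules -/

section Decomposition

variable {h : ℂ} {l₁ l₂ : ℂ}

theorem adm_sub (l₁ l₂ : ℂ) (k : ℕ) : Adm l₁ l₂ (l₁ + l₂ - k) := ⟨k, by ring⟩

/-- The sum of the embeddings `M_{l₁ + l₂ - k} → M_{l₁} ⊗ M_{l₂}`. -/
def embSum (h l₁ l₂ : ℂ) : (ℕ →₀ Verma) →ₗ[ℂ] Verma ⊗[ℂ] Verma :=
  Finsupp.lsum ℂ fun k : ℕ => emb h l₁ l₂ (l₁ + l₂ - k)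

theorem embSum_single (k : ℕ) (v : Verma) :
    embSum h l₁ l₂ (Finsupp.single k v) = emb h l₁ l₂ (l₁ + l₂ - k) v := by
  simp [embSum]

theorem embSum_apply (y : ℕ →₀ Verma) :
    embSum h l₁ l₂ y = ∑ k ∈ y.support, emb h l₁ l₂ (l₁ + l₂ - k) (y k) := rfl

theorem opE_pow_vec_of_lt (h l : ℂ) {m n : ℕ} (hmn : m < n) : (opE h l ^ n) (vec m) = 0 := by
  induction n generalizing m with
  | zero => omega
  | succ n ih =>
    rw [pow_succ, Module.End.mul_apply, opE_vec, map_smul]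
    rcases m with - | m
    · rw [Nat.cast_zero, qnum_zero, zero_mul, zero_smul]
    · rw [Nat.add_sub_cancel, ih (by omega), smul_zero]

theorem opE_pow_vec (hq : NotRootOfUnity h) {l : ℂ} (g : IsGeneric h l) (m : ℕ) :
    ∃ c : ℂ, c ≠ 0 ∧ (opE h l ^ m) (vec m) = c • vec 0 := by
  induction m with
  | zero => exact ⟨1, one_ne_zero, by simp⟩
  | succ m ih =>
    obtain ⟨c, hc, e⟩ := ih
    refine ⟨qnum h (m + 1 : ℕ) * qnum h (2 * l - (m + 1 : ℕ) + 1) * c, ?_, ?_⟩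
    · refine mul_ne_zero (mul_ne_zero ?_ (g.qnum_ne_zero (-m) (by push_cast; ring))) hc
      push_cast
      exact hq.qnum_ne_zero m
    · rw [pow_succ, Module.End.mul_apply, opE_vec, map_smul, Nat.add_sub_cancel, e, smul_smul]

theorem verma_eq_sum {v : Verma} {M : ℕ} (hv : ∀ m, M ≤ m → v m = 0) :
    v = ∑ m ∈ Finset.range M, v m • vec m := by
  refine Finsupp.ext fun m => ?_
  simp only [Finsupp.finsetSum_apply, Finsupp.smul_apply, vec, Finsupp.single_apply, smul_eq_mul,
    mul_ite, mul_one, mul_zero, Finset.sum_ite_eq', Finset.mem_range]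
  split_ifs with hm
  · rfl
  · exact hv m (by omega)

/-- On a family of depth at most M, E^M kills all but the components of depth M and turns those into
nonzero multiples of highest weight vectors. The coordinate (k, 0) sees only the k-th of these, so
the depth can be lowered by one. -/
theorem embSum_injective (hq : NotRootOfUnity h) (g₁ : IsGeneric h l₁) (g₂ : IsGeneric h l₂)
    (g : IsGeneric h (l₁ + l₂)) : Function.Injective (embSum h l₁ l₂) := by
  suffices key : ∀ M : ℕ, ∀ y : ℕ →₀ Verma, (∀ k m, M ≤ m → y k m = 0) → embSum h l₁ l₂ y = 0 →
      y = 0 by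
    refine (injective_iff_map_eq_zero _).mpr fun y hy => ?_
    refine key ((y.support.sup fun k => (y k).support.sup id) + 1) y (fun k m hm => ?_) hy
    by_contra hne
    have h1 : m ≤ (y k).support.sup id :=
      Finset.le_sup (f := id) (Finsupp.mem_support_iff.mpr hne)
    have h2 : (y k).support.sup id ≤ y.support.sup fun k => (y k).support.sup id :=
      Finset.le_sup (f := fun k => (y k).support.sup id)
        (Finsupp.mem_support_iff.mpr fun h0 => hne (by rw [h0]; rfl))
    omega
  intro M
  induction M with
  | zero =>
    intro y hy _
    exact Finsupp.ext fun k => Finsupp.ext fun m => hy k m (Nat.zero_le m)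
  | succ M ih =>
    intro y hy hy0
    refine ih y (fun k m hm => ?_) hy0
    rcases hm.lt_or_eq with hm | rfl
    · exact hy k m hm
    have hE : ∀ (k n : ℕ) (v : Verma), ((verma₂ h l₁ l₂).E ^ n) (emb h l₁ l₂ (l₁ + l₂ - k) v) =
        emb h l₁ l₂ (l₁ + l₂ - k) ((opE h (l₁ + l₂ - k) ^ n) v) := by
      intro k n v
      induction n with
      | zero => rfl
      | succ n ihn =>
        rw [pow_succ', Module.End.mul_apply, ihn, pow_succ', Module.End.mul_apply]
        exact (LinearMap.congr_fun (emb_isHom hq g₁ g₂ (adm_sub l₁ l₂ k)).E _).symm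
    have h1 := congrArg ((verma₂ h l₁ l₂).E ^ M) hy0
    rw [embSum_apply, map_sum, map_zero] at h1
    have h2 : ∀ j : ℕ, ∃ c : ℂ, c ≠ 0 ∧
        ((verma₂ h l₁ l₂).E ^ M) (emb h l₁ l₂ (l₁ + l₂ - j) (y j)) =
          (c * y j M) • hwVec h l₁ l₂ (l₁ + l₂ - j) := by
      intro j
      obtain ⟨c, hc, e⟩ := opE_pow_vec hq (g.sub_natCast j) M
      refine ⟨c, hc, ?_⟩
      conv_lhs => rw [hE, verma_eq_sum (hy j)]
      rw [Finset.sum_range_succ, map_add, map_sum, Finset.sum_eq_zero,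
        zero_add, map_smul, e, smul_smul, map_smul, emb_vec_zero, mul_comm]
      intro m hm
      rw [map_smul, opE_pow_vec_of_lt _ _ (Finset.mem_range.mp hm), smul_zero]
    choose c hc e using h2
    simp only [e] at h1
    have h3 := congrArg (coord k 0) h1
    rw [map_sum, map_zero, Finset.sum_eq_single k] at h3
    · rw [map_smul, coord_hwVec h (n := k) (by ring), if_pos (by omega), smul_eq_mul] at h3
      refine ((mul_eq_zero.mp ((mul_eq_zero.mp h3).resolve_right ?_)).resolve_left (hc k))
      exact mul_ne_zero (Delta_ne_zero hq g₁ g₂ (g.sub_natCast k)) (hwCoeff_ne_zero hq g₁ g₂ k 0)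
    · intro j _ hj
      rw [map_smul, coord_hwVec h (n := j) (by ring), if_neg (by omega), smul_zero]
    · intro hk
      rw [Finsupp.notMem_support_iff.mp hk]
      simp

theorem mem_of_vec_mem {S : Submodule ℂ (Verma ⊗[ℂ] Verma)}
    (hS : ∀ i j, vec i ⊗ₜ[ℂ] vec j ∈ S) (x : Verma ⊗[ℂ] Verma) : x ∈ S := by
  have h1 : ∀ (i : ℕ) (w : Verma), vec i ⊗ₜ[ℂ] w ∈ S := fun i w => by
    induction w using Finsupp.induction_linear with
    | zero => simp
    | add u v hu hv => rw [TensorProduct.tmul_add]; exact S.add_mem hu hv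
    | single j c =>
      rw [← mul_one c, ← smul_eq_mul, ← Finsupp.smul_single, TensorProduct.tmul_smul]
      exact S.smul_mem c (hS i j)
  induction x using TensorProduct.induction_on with
  | zero => exact S.zero_mem
  | add x y hx hy => exact S.add_mem hx hy
  | tmul v w =>
    induction v using Finsupp.induction_linear with
    | zero => simp
    | add u v hu hv => rw [TensorProduct.add_tmul]; exact S.add_mem hu hv
    | single i c =>
      rw [← mul_one c, ← smul_eq_mul, ← Finsupp.smul_single, ← TensorProduct.smul_tmul']
      exact S.smul_mem c (h1 i w)

/-- Dimension count by weight: both sides have dimension i + j + 1 in the weight of the given basis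
vector, so injectivity forces surjectivity. -/
theorem embSum_surjective (hq : NotRootOfUnity h) (g₁ : IsGeneric h l₁) (g₂ : IsGeneric h l₂)
    (g : IsGeneric h (l₁ + l₂)) : Function.Surjective (embSum h l₁ l₂) := by
  suffices key : ∀ i j, vec i ⊗ₜ[ℂ] vec j ∈ LinearMap.range (embSum h l₁ l₂) by
    exact fun x => mem_of_vec_mem key x
  intro i j
  have hw : ∀ k m a b : ℕ, a + b ≠ k + m →
      coord a b (emb h l₁ l₂ (l₁ + l₂ - k) (vec m)) = 0 := by
    intro k m a b hab
    refine coord_eq_zero_of_H ((emb_isHom hq g₁ g₂ (adm_sub l₁ l₂ k)).H_vec m) fun e => hab ?_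
    have : (a : ℂ) + b = k + m := by linear_combination -e
    exact_mod_cast this
  -- Parametrises the vectors of the required weight in the direct sum: depth i + j - k in the k-th
  -- summand. Then `T` reads the coordinates of their images on the antidiagonal, and is an
  -- endomorphism of a finite-dimensional space.
  let y : (Fin (i + j + 1) → ℂ) →ₗ[ℂ] (ℕ →₀ Verma) :=
    ∑ k : Fin (i + j + 1), (Finsupp.lsingle (k : ℕ) ∘ₗ
      Finsupp.lsingle (i + j - k)) ∘ₗ LinearMap.proj k
  have hy : ∀ a, y a = ∑ k : Fin (i + j + 1), a k • Finsupp.single (k : ℕ) (vec (i + j - k)) := by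
    intro a
    simp only [y, LinearMap.sum_apply, LinearMap.comp_apply, LinearMap.proj_apply,
      Finsupp.lsingle_apply, vec]
    refine Finset.sum_congr rfl fun k _ => ?_
    rw [Finsupp.smul_single, Finsupp.smul_single, smul_eq_mul, mul_one]
  let T : (Fin (i + j + 1) → ℂ) →ₗ[ℂ] (Fin (i + j + 1) → ℂ) :=
    LinearMap.pi fun n => coord n (i + j - n) ∘ₗ embSum h l₁ l₂ ∘ₗ y
  have hyw : ∀ a p r, p + r ≠ i + j → coord p r (embSum h l₁ l₂ (y a)) = 0 := by
    intro a p r hpr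
    rw [hy, map_sum, map_sum, Finset.sum_eq_zero]
    intro k _
    rw [map_smul, map_smul, embSum_single, hw _ _ _ _ (by omega), smul_zero]
  have hyi : Function.Injective y := by
    refine (injective_iff_map_eq_zero y).mpr fun a ha => funext fun k => ?_
    have := congrArg (fun z => z (k : ℕ) (i + j - k)) ha
    simp only [hy, Finsupp.finsetSum_apply, Finsupp.smul_apply, Finsupp.single_apply] at this
    rw [Finset.sum_eq_single k] at this
    · simpa [vec] using this
    · intro k' _ hk'
      rw [if_neg (fun e => hk' (Fin.ext e))]
      simp
    · simp
  have hT : Function.Injective T := by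
    refine (injective_iff_map_eq_zero T).mpr fun a ha => ?_
    refine hyi ?_
    rw [map_zero]
    refine embSum_injective hq g₁ g₂ g ?_
    rw [map_zero]
    refine eq_of_coord fun p r => ?_
    rw [map_zero]
    by_cases hpr : p + r = i + j
    · have := congrFun ha ⟨p, by omega⟩
      simp only [T, LinearMap.pi_apply, LinearMap.comp_apply, Pi.zero_apply] at this
      rwa [show i + j - p = r by omega] at this
    · exact hyw a p r hpr
  obtain ⟨a, ha⟩ := (LinearMap.injective_iff_surjective.mp hT) (Pi.single ⟨i, by omega⟩ 1)
  refine ⟨y a, eq_of_coord fun p r => ?_⟩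
  rw [coord_vec]
  by_cases hpr : p + r = i + j
  · have := congrFun ha ⟨p, by omega⟩
    simp only [T, LinearMap.pi_apply, LinearMap.comp_apply] at this
    rw [show i + j - p = r by omega] at this
    rw [this, Pi.single_apply]
    refine if_congr ?_ rfl rfl
    rw [Fin.mk.injEq]
    omega
  · rw [hyw a p r hpr, if_neg (by omega)]

/-- The projections of `M_{l₁} ⊗ M_{l₂}` onto its summands `M_{l₁ + l₂ - k}`. -/
structure IsProj (h l₁ l₂ : ℂ) (π : ℕ → (Verma ⊗[ℂ] Verma →ₗ[ℂ] Verma)) : Prop where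
  proj_emb : ∀ k k' : ℕ, π k ∘ₗ emb h l₁ l₂ (l₁ + l₂ - k') = if k = k' then LinearMap.id else 0
  sum_proj : ∀ x, ∃ K₀, ∀ K, K₀ ≤ K →
    x = ∑ k ∈ Finset.range K, emb h l₁ l₂ (l₁ + l₂ - k) (π k x)

theorem exists_isProj (hq : NotRootOfUnity h) (g₁ : IsGeneric h l₁) (g₂ : IsGeneric h l₂)
    (g : IsGeneric h (l₁ + l₂)) : ∃ π, IsProj h l₁ l₂ π := by
  let Φ := LinearEquiv.ofBijective (embSum h l₁ l₂)
    ⟨embSum_injective hq g₁ g₂ g, embSum_surjective hq g₁ g₂ g⟩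
  refine ⟨fun k => Finsupp.lapply k ∘ₗ Φ.symm.toLinearMap, ⟨fun k k' => ?_, fun x => ?_⟩⟩
  · refine LinearMap.ext fun v => ?_
    have : Φ.symm (emb h l₁ l₂ (l₁ + l₂ - k') v) = Finsupp.single k' v := by
      rw [LinearEquiv.symm_apply_eq]
      exact (embSum_single k' v).symm
    simp only [LinearMap.comp_apply, LinearEquiv.coe_coe, this, Finsupp.lapply_apply,
      Finsupp.single_apply]
    by_cases e : k = k'
    · rw [if_pos e.symm, if_pos e]; rfl
    · rw [if_neg (Ne.symm e), if_neg e]; rfl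
  · refine ⟨(Φ.symm x).support.sup id + 1, fun K hK => ?_⟩
    have h1 : embSum h l₁ l₂ (Φ.symm x) = x := Φ.apply_symm_apply x
    conv_lhs => rw [← h1, embSum_apply]
    refine Finset.sum_subset (fun k hk => ?_) fun k _ hk => ?_
    · have := Finset.le_sup (f := id) hk
      simp only [id, Finset.mem_range] at this ⊢
      omega
    · rw [Finsupp.notMem_support_iff.mp hk, map_zero]

end Decomposition

section LinearMapSum

variable {U V W : Type} [AddCommMonoid U] [Module ℂ U] [AddCommMonoid V] [Module ℂ V]
  [AddCommMonoid W] [Module ℂ W]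

theorem linearMap_comp_sum (s : Finset ℕ) (g : V →ₗ[ℂ] W) (f : ℕ → (U →ₗ[ℂ] V)) :
    g ∘ₗ (∑ k ∈ s, f k) = ∑ k ∈ s, g ∘ₗ f k :=
  LinearMap.ext fun x => by simp

theorem linearMap_sum_comp (s : Finset ℕ) (g : ℕ → (V →ₗ[ℂ] W)) (f : U →ₗ[ℂ] V) :
    (∑ k ∈ s, g k) ∘ₗ f = ∑ k ∈ s, g k ∘ₗ f :=
  LinearMap.ext fun x => by simp

end LinearMapSum

/-! ### The `q6j`-symbols as recoupling coefficients -/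

section Racah

variable {h : ℂ}

theorem IsProj.proj_apply {l₁ l₂ : ℂ} {π : ℕ → (Verma ⊗[ℂ] Verma →ₗ[ℂ] Verma)}
    (hπ : IsProj h l₁ l₂ π) (k k' : ℕ) (v : Verma) :
    π k (emb h l₁ l₂ (l₁ + l₂ - k') v) = if k = k' then v else 0 := by
  rw [← LinearMap.comp_apply, hπ.proj_emb]
  split_ifs <;> rfl

theorem IsProj.comm {l₁ l₂ : ℂ} {π : ℕ → (Verma ⊗[ℂ] Verma →ₗ[ℂ] Verma)}
    (hπ : IsProj h l₁ l₂ π) {X : Module.End ℂ (Verma ⊗[ℂ] Verma)} {Y : ℕ → Module.End ℂ Verma}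
    (hXY : ∀ k : ℕ, emb h l₁ l₂ (l₁ + l₂ - k) ∘ₗ Y k = X ∘ₗ emb h l₁ l₂ (l₁ + l₂ - k)) (k : ℕ) :
    π k ∘ₗ X = Y k ∘ₗ π k := by
  refine LinearMap.ext fun x => ?_
  obtain ⟨K₀, hK⟩ := hπ.sum_proj x
  -- The truncation must be long enough to represent x and also to contain the index k.
  have hx := hK (max K₀ (k + 1)) (le_max_left _ _)
  have h1 : ∀ j : ℕ, X (emb h l₁ l₂ (l₁ + l₂ - j) (π j x)) =
      emb h l₁ l₂ (l₁ + l₂ - j) (Y j (π j x)) := fun j => (LinearMap.congr_fun (hXY j) _).symm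
  rw [LinearMap.comp_apply, LinearMap.comp_apply]
  conv_lhs => rw [hx]
  simp only [map_sum, h1, hπ.proj_apply]
  rw [Finset.sum_ite_eq, if_pos]
  rw [Finset.mem_range]
  omega

theorem IsProj.isHom (hq : NotRootOfUnity h) {l₁ l₂ : ℂ} (g₁ : IsGeneric h l₁)
    (g₂ : IsGeneric h l₂) {π : ℕ → (Verma ⊗[ℂ] Verma →ₗ[ℂ] Verma)} (hπ : IsProj h l₁ l₂ π)
    (k : ℕ) : (verma₂ h l₁ l₂).IsHom (verma h (l₁ + l₂ - k)) (π k) where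
  E := hπ.comm (Y := fun k => (verma h (l₁ + l₂ - k)).E)
    (fun k => (emb_isHom hq g₁ g₂ (adm_sub l₁ l₂ k)).E) k
  F := hπ.comm (Y := fun k => (verma h (l₁ + l₂ - k)).F)
    (fun k => (emb_isHom hq g₁ g₂ (adm_sub l₁ l₂ k)).F) k
  K := hπ.comm (Y := fun k => (verma h (l₁ + l₂ - k)).K)
    (fun k => (emb_isHom hq g₁ g₂ (adm_sub l₁ l₂ k)).K) k
  L := hπ.comm (Y := fun k => (verma h (l₁ + l₂ - k)).L)
    (fun k => (emb_isHom hq g₁ g₂ (adm_sub l₁ l₂ k)).L) k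
  H := hπ.comm (Y := fun k => (verma h (l₁ + l₂ - k)).H)
    (fun k => (emb_isHom hq g₁ g₂ (adm_sub l₁ l₂ k)).H) k

theorem IsProj.sum_proj_lTensor {l₁ l₂ : ℂ} {π : ℕ → (Verma ⊗[ℂ] Verma →ₗ[ℂ] Verma)}
    (hπ : IsProj h l₁ l₂ π) (x : Verma ⊗[ℂ] (Verma ⊗[ℂ] Verma)) :
    ∃ K₀, ∀ K, K₀ ≤ K → x = ∑ k ∈ Finset.range K,
      TensorProduct.map LinearMap.id (emb h l₁ l₂ (l₁ + l₂ - k))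
        (TensorProduct.map LinearMap.id (π k) x) := by
  induction x using TensorProduct.induction_on with
  | zero => exact ⟨0, fun K _ => by simp⟩
  | tmul v w =>
    obtain ⟨K₀, hK⟩ := hπ.sum_proj w
    refine ⟨K₀, fun K h0 => ?_⟩
    simp only [TensorProduct.map_tmul, LinearMap.id_apply]
    rw [← TensorProduct.tmul_sum, ← hK K h0]
  | add x y hx hy =>
    obtain ⟨K₁, hx⟩ := hx
    obtain ⟨K₂, hy⟩ := hy
    refine ⟨max K₁ K₂, fun K h0 => ?_⟩
    simp only [map_add, Finset.sum_add_distrib]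
    rw [← hx K (le_of_max_le_left h0), ← hy K (le_of_max_le_right h0)]

/-- Insert the decomposition of the last two factors. Each component is a homomorphism from `M_l`
into a product of two Verma modules, hence a multiple of `emb`, and is zero once k exceeds n. -/
theorem exists_isTransition (hq : NotRootOfUnity h) {l₁ l₂ l₁₂ l₃ l : ℂ} (g₁ : IsGeneric h l₁)
    (g₂ : IsGeneric h l₂) (g₃ : IsGeneric h l₃) (g₁₂ : IsGeneric h l₁₂)
    (g₂₃ : IsGeneric h (l₂ + l₃)) (g : IsGeneric h l) (ha : Adm l₁ l₂ l₁₂) (hb : Adm l₁₂ l₃ l) :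
    ∃ c, IsTransition h l₁ l₂ l₁₂ l₃ l c := by
  obtain ⟨n, hn⟩ : ∃ n : ℕ, l₁ + l₂ + l₃ - l = n := by
    obtain ⟨a, ha⟩ := ha
    obtain ⟨b, hb⟩ := hb
    exact ⟨a + b, by push_cast; linear_combination ha + hb⟩
  obtain ⟨π, hπ⟩ := exists_isProj hq g₂ g₃ g₂₃
  have hφ := leftEmb_isHom hq g₁ g₂ g₃ g₁₂ ha hb
  have hc : ∀ k : ℕ, (verma h l).IsHom (verma₂ h l₁ (l₂ + l₃ - k))
      (TensorProduct.map LinearMap.id (π k) ∘ₗ leftEmb h l₁ l₂ l₁₂ l₃ l) := fun k =>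
    ((Ops.IsHom.id (verma h l₁)).map (hπ.isHom hq g₂ g₃ k)).comp hφ
  have hadm : ∀ k : ℕ, k ≤ n → l₁ + (l₂ + l₃ - k) - l = (n - k : ℕ) := fun k hk => by
    rw [Nat.cast_sub hk]
    linear_combination hn
  have hc1 : ∀ k : ℕ, ∃ c : ℂ, k ≤ n →
      TensorProduct.map LinearMap.id (π k) ∘ₗ leftEmb h l₁ l₂ l₁₂ l₃ l =
        c • emb h l₁ (l₂ + l₃ - k) l := fun k => by
    by_cases hk : k ≤ n
    · exact ⟨_, fun _ => hom_eq_smul_emb hq g₁ (g₂₃.sub_natCast k) g (hc k) (hadm k hk)⟩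
    · exact ⟨0, fun h0 => absurd h0 hk⟩
  choose c hc1 using hc1
  refine ⟨c, ?_⟩
  rw [IsTransition, gap_eq hn]
  -- The resolution of the identity is finite only vector by vector, so it is used at the highest
  -- weight vector alone.
  refine verma_ext_of_comm hφ.F ?_ ?_
  · rw [linearMap_sum_comp, linearMap_comp_sum]
    refine Finset.sum_congr rfl fun k hk => ?_
    have hr : rightEmb h l₁ l₂ l₃ l (l₂ + l₃ - k) ∘ₗ opF = _ := (rightEmb_isHom hq g₁ g₂ g₃
      (g₂₃.sub_natCast k) (adm_sub l₂ l₃ k)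
      ⟨n - k, hadm k (by have := Finset.mem_range.mp hk; omega)⟩).F
    rw [LinearMap.smul_comp, hr, LinearMap.comp_smul]
  · obtain ⟨K₀, hK⟩ := hπ.sum_proj_lTensor (leftEmb h l₁ l₂ l₁₂ l₃ l (vec 0))
    rw [hK (max K₀ (n + 1)) (le_max_left _ _), LinearMap.sum_apply]
    symm
    refine Finset.sum_subset_zero_on_sdiff
      (Finset.range_mono (le_max_right _ _)) (fun k hk => ?_) fun k hk => ?_
    · have hkn : n < k := by
        simp only [Finset.mem_sdiff, Finset.mem_range] at hk
        omega
      rw [← LinearMap.comp_apply (TensorProduct.map LinearMap.id (π k)),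
        hom_eq_zero hq (g₂₃.sub_natCast k) (hc k), LinearMap.zero_apply, map_zero]
      rintro ⟨m, hm⟩
      have : (n : ℂ) = (k + m : ℕ) := by push_cast; linear_combination hm - hn
      have : n = k + m := by exact_mod_cast this
      omega
    · have hkn : k ≤ n := by
        simp only [Finset.mem_range] at hk
        omega
      rw [← LinearMap.comp_apply (TensorProduct.map LinearMap.id (π k)), hc1 k hkn,
        LinearMap.smul_apply, LinearMap.smul_apply, map_smul]
      rfl

/-- For k ≤ n all four triples are admissible and `gap` returns k, so the symbol is the k-th entry
of the chosen family. Uniqueness of that family is not needed. -/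
theorem leftEmb_eq_sum (hq : NotRootOfUnity h) {l₁ l₂ l₁₂ l₃ l : ℂ} (g₁ : IsGeneric h l₁)
    (g₂ : IsGeneric h l₂) (g₃ : IsGeneric h l₃) (g₁₂ : IsGeneric h l₁₂)
    (g₂₃ : IsGeneric h (l₂ + l₃)) (g : IsGeneric h l) (ha : Adm l₁ l₂ l₁₂) (hb : Adm l₁₂ l₃ l)
    {n : ℕ} (hn : l₁ + l₂ + l₃ - l = n) :
    leftEmb h l₁ l₂ l₁₂ l₃ l = ∑ k ∈ Finset.range (n + 1),
      q6j h l₁ l₂ l₁₂ l₃ l (l₂ + l₃ - k) • rightEmb h l₁ l₂ l₃ l (l₂ + l₃ - k) := by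
  have hex := exists_isTransition hq g₁ g₂ g₃ g₁₂ g₂₃ g ha hb
  have := hex.choose_spec
  rw [IsTransition, gap_eq hn] at this
  rw [this]
  refine Finset.sum_congr rfl fun k hk => ?_
  congr 1
  have hk : k ≤ n := by have := Finset.mem_range.mp hk; omega
  have h4 : Adm l₁ (l₂ + l₃ - k) l := ⟨n - k, by rw [Nat.cast_sub hk]; linear_combination hn⟩
  rw [q6j, dif_pos ⟨⟨ha, hb, adm_sub l₂ l₃ k, h4⟩, hex⟩, gap_eq (n := k) (by ring)]

theorem q6j_eq_zero_of_not_adm {l₁ l₂ l₁₂ l₃ l l₂₃ : ℂ} (ha : ¬ Adm l₁ l₂₃ l) :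
    q6j h l₁ l₂ l₁₂ l₃ l l₂₃ = 0 := dif_neg fun hc => ha hc.1.2.2.2

/-- The `q6j`-symbols are the components of the iterated embedding. -/
theorem IsProj.proj_leftEmb (hq : NotRootOfUnity h) {l₁ l₂ l₁₂ l₃ l : ℂ} (g₁ : IsGeneric h l₁)
    (g₂ : IsGeneric h l₂) (g₃ : IsGeneric h l₃) (g₁₂ : IsGeneric h l₁₂)
    (g₂₃ : IsGeneric h (l₂ + l₃)) (g : IsGeneric h l) (ha : Adm l₁ l₂ l₁₂) (hb : Adm l₁₂ l₃ l)
    {π : ℕ → (Verma ⊗[ℂ] Verma →ₗ[ℂ] Verma)} (hπ : IsProj h l₂ l₃ π) (u : ℕ) :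
    TensorProduct.map LinearMap.id (π u) ∘ₗ leftEmb h l₁ l₂ l₁₂ l₃ l =
      q6j h l₁ l₂ l₁₂ l₃ l (l₂ + l₃ - u) • emb h l₁ (l₂ + l₃ - u) l := by
  obtain ⟨n, hn⟩ : ∃ n : ℕ, l₁ + l₂ + l₃ - l = n := by
    obtain ⟨a, ha⟩ := ha
    obtain ⟨b, hb⟩ := hb
    exact ⟨a + b, by push_cast; linear_combination ha + hb⟩
  rw [leftEmb_eq_sum hq g₁ g₂ g₃ g₁₂ g₂₃ g ha hb hn, linearMap_comp_sum]
  have key : ∀ k : ℕ, TensorProduct.map LinearMap.id (π u) ∘ₗ rightEmb h l₁ l₂ l₃ l (l₂ + l₃ - k) =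
      if u = k then emb h l₁ (l₂ + l₃ - u) l else 0 := by
    intro k
    rw [rightEmb, ← LinearMap.comp_assoc, ← TensorProduct.map_comp, hπ.proj_emb]
    split_ifs with e
    · rw [e, LinearMap.comp_id, TensorProduct.map_id, LinearMap.id_comp]
    · rw [TensorProduct.map_zero_right, LinearMap.zero_comp]
  simp only [LinearMap.comp_smul, key, smul_ite, smul_zero]
  rw [Finset.sum_ite_eq]
  split_ifs with hu
  · rfl
  · rw [q6j_eq_zero_of_not_adm, zero_smul]
    rintro ⟨m, hm⟩
    have : (n : ℂ) = (u + m : ℕ) := by push_cast; linear_combination hm - hn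
    have : n = u + m := by exact_mod_cast this
    simp only [Finset.mem_range] at hu
    omega

end Racah

/-! ### Coefficients of the `R`-matrix -/

section Braiding

variable {h : ℂ}

/-- The matrix coefficient of `E ^ n` from `e_{μ - m}` to `e_{μ - m + n}`. -/
def raise (h μ : ℂ) (m n : ℕ) : ℂ :=
  ∏ s ∈ Finset.range n, qnum h ((m : ℂ) - s) * qnum h (2 * μ - m + s + 1)

/-- The powers of `q` in `braidCoeff`. -/
def braidExp (h a b : ℂ) (n : ℕ) : ℂ := qpow h (-2 * a * b + n * (b - a) + n * (n + 1) / 2)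

/-- The coefficients of the universal `R`-matrix on the tensor product of a vector of weight `a` and
`e_{μ - m}`. -/
def braidCoeff (h μ a : ℂ) (m n : ℕ) : ℂ :=
  (qpow h (-1) - qpow h 1) ^ n * braidExp h a (μ - m) n / qfact h n * raise h μ m n

theorem raise_succ (h μ : ℂ) (m n : ℕ) : raise h μ m (n + 1) =
    raise h μ m n * (qnum h ((m : ℂ) - n) * qnum h (2 * μ - m + n + 1)) :=
  Finset.prod_range_succ _ _

theorem raise_succ_succ (h μ : ℂ) (m n : ℕ) : raise h μ (m + 1) (n + 1) =
    qnum h ((m : ℂ) + 1) * qnum h (2 * μ - m) * raise h μ m n := by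
  rw [raise, Finset.prod_range_succ', mul_comm, raise]
  congr 1
  · congr 2 <;> push_cast <;> ring
  · refine Finset.prod_congr rfl fun s _ => ?_
    congr 2 <;> push_cast <;> ring

theorem raise_eq_zero (h μ : ℂ) {m n : ℕ} (hmn : m < n) : raise h μ m n = 0 :=
  Finset.prod_eq_zero (Finset.mem_range.mpr hmn) (by rw [sub_self, qnum_zero, zero_mul])

theorem raise_add (h μ : ℂ) {m n : ℕ} (hn : n ≤ m) (r : ℕ) :
    raise h μ m (n + r) = raise h μ m n * raise h μ (m - n) r := by
  rw [raise, Finset.prod_range_add, raise, raise]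
  congr 1
  refine Finset.prod_congr rfl fun s _ => ?_
  rw [Nat.cast_sub hn]
  congr 2 <;> push_cast <;> ring

theorem braidCoeff_eq_zero (h μ a : ℂ) {m n : ℕ} (hmn : m < n) : braidCoeff h μ a m n = 0 := by
  rw [braidCoeff, raise_eq_zero h μ hmn, mul_zero]

theorem braidCoeff_zero (h μ a : ℂ) (m : ℕ) :
    braidCoeff h μ a m 0 = qpow h (-2 * a * (μ - m)) := by
  simp [braidCoeff, braidExp, raise, qfact]

theorem qfact_succ (h : ℂ) (n : ℕ) : qfact h (n + 1) = qfact h n * qnum h ((n : ℂ) + 1) :=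
  Finset.prod_range_succ _ _

theorem NotRootOfUnity.sub_ne_zero {h : ℂ} (hq : NotRootOfUnity h) (n : ℕ) :
    qpow h n * qpow h 1 - (qpow h n * qpow h 1)⁻¹ ≠ 0 := by
  have := hq.qnum_ne_zero n
  rw [qnum, qpow_neg, qpow_add] at this
  exact (div_ne_zero_iff.mp this).1

theorem NotRootOfUnity.sub_inv_ne_zero {h : ℂ} (hq : NotRootOfUnity h) :
    qpow h 1 - (qpow h 1)⁻¹ ≠ 0 := by
  have := hq.sub_ne_zero 0
  rwa [Nat.cast_zero, qpow_zero, one_mul] at this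

/-- Here d stands for q - q⁻¹. The extra factor -d in the next `R`-matrix coefficient cancels the
surplus denominators of two q-numbers in `raise` against the one in the q-factorial. -/
theorem braid_frac {d : ℂ} (T X Q D P : ℂ) (hd : d ≠ 0) {u v : ℂ} :
    T * -d * X / (Q * (D / d)) * (u / d * (v / d) * P) = -T * X / Q * D⁻¹ * u * v * P := by
  field_simp

theorem braid_frac' {d : ℂ} (T X Q D P : ℂ) (hd : d ≠ 0) {u v : ℂ} :
    T * -d * X / (Q * (D / d)) * (P * (u / d * (v / d))) = -T * X / Q * D⁻¹ * u * v * P := by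
  rw [← braid_frac T X Q D P hd]
  ring

/-- With a = l - i, this compares the coefficients of `vec (m - n) ⊗ₜ vec (i + n + 1)` in the
statement that the braiding commutes with `F`. -/
theorem braidCoeff_F (hq : NotRootOfUnity h) (μ a : ℂ) (m n : ℕ) :
    qpow h (μ - m) * braidCoeff h μ (a - 1) m n +
        qpow h (-a) * braidCoeff h μ a (m + 1) (n + 1) =
      braidCoeff h μ a m (n + 1) * qpow h (a - (n + 1 : ℕ)) +
        braidCoeff h μ a m n * qpow h (-(μ - m + n)) := by
  obtain ⟨b, rfl⟩ : ∃ b, μ = b + m := ⟨μ - m, by ring⟩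
  have d1 : b + m - (m : ℂ) = b := by ring
  have d2 : b + m - ((m + 1 : ℕ) : ℂ) = b - 1 := by push_cast; ring
  have d3 : 2 * (b + m) - m = b + b + (m : ℂ) := by ring
  have d4 : a - ((n + 1 : ℕ) : ℂ) = a + -n + -1 := by push_cast; ring
  have d5 : (m : ℂ) - n = m + -n := by ring
  have e1 : braidExp h (a - 1) b n = braidExp h a b n * (qpow h b * qpow h b * qpow h n) := by
    simp only [braidExp, ← qpow_add]
    congr 1; ring
  have e2 : braidExp h a (b - 1) (n + 1) = braidExp h a b n * (qpow h a * qpow h b) := by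
    simp only [braidExp, ← qpow_add]
    congr 1; push_cast; ring
  have e3 : braidExp h a b (n + 1) =
      braidExp h a b n * (qpow h b * qpow h (-a) * qpow h n * qpow h 1) := by
    simp only [braidExp, ← qpow_add]
    congr 1; push_cast; ring
  simp only [braidCoeff, raise_succ_succ, raise_succ, qfact_succ, pow_succ]
  simp only [d1, d2, d3, d4, d5, e1, e2, e3]
  simp only [qnum, qpow_add, qpow_neg, neg_add, neg_neg]
  have h1 := qpow_ne_zero h 1
  have h2 := hq.sub_ne_zero n
  have h3 := hq.sub_inv_ne_zero
  have h4 := qpow_ne_zero h a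
  have h5 := qpow_ne_zero h b
  have h6 := qpow_ne_zero h n
  have h7 := qpow_ne_zero h m
  have h8 := hq.qfact_ne_zero n
  generalize qpow h 1 = q at *
  generalize qpow h a = A at *
  generalize qpow h b = B at *
  generalize qpow h n = N at *
  generalize qpow h m = M at *
  generalize braidExp h a b n = G at *
  generalize raise h _ m n = P at *
  generalize qfact h n = Q at *
  clear e1 e2 e3 d1 d2 d3 d4 d5 hq
  generalize (q⁻¹ - q) ^ n = T at *
  -- What is left after removing the common factor T G P / Q: an identity of rational functions in
  -- the powers of q.
  have key : B * (B * B * N) - (N * q - (N * q)⁻¹)⁻¹ * (A⁻¹ * (A * B)) *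
      ((M * q - M⁻¹ * q⁻¹) * (B * B * M - B⁻¹ * B⁻¹ * M⁻¹)) =
      -(N * q - (N * q)⁻¹)⁻¹ * (B * A⁻¹ * N * q) * (A * N⁻¹ * q⁻¹) *
        ((M * N⁻¹ - M⁻¹ * N) * (B * B * M * N * q - B⁻¹ * B⁻¹ * M⁻¹ * N⁻¹ * q⁻¹)) +
      B⁻¹ * N⁻¹ := by
    have h2' : N ^ 2 * q ^ 2 - 1 ≠ 0 := fun e => h2 (by field_simp; linear_combination e)
    have : (N * q - (N * q)⁻¹)⁻¹ = (N * q) * (N ^ 2 * q ^ 2 - 1)⁻¹ := by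
      field_simp
    rw [this]
    field_simp
    ring
  have : N⁻¹ * q⁻¹ = (N * q)⁻¹ := by rw [mul_inv]
  have k2 : ((q⁻¹ - q) : ℂ) = -(q - q⁻¹) := by ring
  generalize hD : (N * q - (N * q)⁻¹) = D at *
  generalize hd : q - q⁻¹ = d at *
  have k3 : N * q - N⁻¹ * q⁻¹ = D := by rw [this, hD]
  rw [k2, k3, braid_frac _ _ _ _ _ h3, braid_frac' _ _ _ _ _ h3]
  linear_combination (T * G * P / Q) * key

/-- The analogue for `E`, at `vec (m - n) ⊗ₜ vec (i + n)` in the image of `vec i ⊗ₜ vec (m + 1)`. -/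
theorem braidCoeff_E (hq : NotRootOfUnity h) (μ l : ℂ) (i m n : ℕ) :
    qnum h i * qnum h (2 * l - i + 1) * qpow h (μ - (m + 1 : ℕ)) *
          braidCoeff h μ (l - i + 1) (m + 1) (n + 1) +
        qpow h (-(l - i)) * (qnum h (m + 1 : ℕ) * qnum h (2 * μ - (m + 1 : ℕ) + 1)) *
          braidCoeff h μ (l - i) m n =
      braidCoeff h μ (l - i) (m + 1) n *
          (qnum h ((m + 1 : ℕ) - n) * qnum h (2 * μ - (m + 1 : ℕ) + n + 1) * qpow h (l - i - n)) +
        braidCoeff h μ (l - i) (m + 1) (n + 1) * (qpow h (-(μ - (m + 1 : ℕ) + (n + 1 : ℕ))) *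
          (qnum h (i + (n + 1) : ℕ) * qnum h (2 * l - (i + (n + 1) : ℕ) + 1))) := by
  obtain ⟨a, rfl⟩ : ∃ a, l = a + i := ⟨l - i, by ring⟩
  obtain ⟨b, rfl⟩ : ∃ b, μ = b + (m + 1 : ℕ) := ⟨μ - (m + 1 : ℕ), by ring⟩
  have d1 : a + i - (i : ℂ) = a := by ring
  have d2 : b + ((m + 1 : ℕ) : ℂ) - ((m + 1 : ℕ) : ℂ) = b := by ring
  have d3 : b + ((m + 1 : ℕ) : ℂ) - m = b + 1 := by push_cast; ring
  have d4 : 2 * (a + i) - (i : ℂ) + 1 = a + a + i + 1 := by ring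
  have d5 : ((i + (n + 1) : ℕ) : ℂ) = i + n + 1 := by push_cast; ring
  have d6 : 2 * (a + i) - ((i + (n + 1) : ℕ) : ℂ) + 1 = a + a + i + -n := by push_cast; ring
  have d7 : 2 * (b + ((m + 1 : ℕ) : ℂ)) - ((m + 1 : ℕ) : ℂ) + 1 =
    2 * (b + ((m + 1 : ℕ) : ℂ)) - m := by push_cast; ring
  have d8 : a - (n : ℂ) = a + -n := by ring
  have d9 : b + ((n + 1 : ℕ) : ℂ) = b + n + 1 := by push_cast; ring
  -- The same product is split off at its first and at its last factor, which relates the three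
  -- values of `raise` that occur.
  have p1 := raise_succ_succ h (b + (m + 1 : ℕ)) m n
  have p2 := raise_succ h (b + (m + 1 : ℕ)) (m + 1) n
  have e1 : braidExp h (a + 1) b (n + 1) = braidExp h a b n * (qpow h (-b) * qpow h (-a)) := by
    simp only [braidExp, ← qpow_add]
    congr 1; push_cast; ring
  have e2 : braidExp h a (b + 1) n =
      braidExp h a b n * (qpow h (-a) * qpow h (-a) * qpow h n) := by
    simp only [braidExp, ← qpow_add]
    congr 1; ring
  have e3 : braidExp h a b (n + 1) =
      braidExp h a b n * (qpow h b * qpow h (-a) * qpow h n * qpow h 1) := by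
    simp only [braidExp, ← qpow_add]
    congr 1; push_cast; ring
  simp only [braidCoeff, qfact_succ, pow_succ]
  simp only [d1, d2, d3, d4, d6, d7, d8, d9, e1, e2, e3]
  clear d1 d2 d3 d4 d6 d8 d9 e1 e2 e3
  generalize raise h _ (m + 1) (n + 1) = P at *
  generalize raise h _ (m + 1) n = R₁ at *
  generalize raise h _ m n = R₀ at *
  clear d7
  rw [d5]
  rw [show ((m + 1 : ℕ) : ℂ) = (m : ℂ) + 1 by push_cast; ring] at p1 p2 ⊢
  generalize qnum h ((m : ℂ) + 1) = r₁ at *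
  generalize qnum h (2 * (b + ((m : ℂ) + 1)) - m) = r₂ at *
  generalize qnum h ((m : ℂ) + 1 - n) = s₁ at *
  generalize qnum h (2 * (b + ((m : ℂ) + 1)) - (m + 1) + n + 1) = s₂ at *
  simp only [qnum, qpow_add, qpow_neg, neg_add, neg_neg]
  have h1 := qpow_ne_zero h 1
  have h2 := hq.sub_ne_zero n
  have h3 := hq.sub_inv_ne_zero
  have h4 := qpow_ne_zero h a
  have h5 := qpow_ne_zero h b
  have h6 := qpow_ne_zero h n
  have h7 := qpow_ne_zero h i
  have h8 := hq.qfact_ne_zero n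
  generalize qpow h 1 = q at *
  generalize qpow h a = A at *
  generalize qpow h b = B at *
  generalize qpow h n = N at *
  generalize qpow h i = M at *
  generalize braidExp h a b n = G at *
  generalize qfact h n = Q at *
  generalize (q⁻¹ - q) ^ n = T at *
  clear d5 hq
  have key : -(N * q - (N * q)⁻¹)⁻¹ * (B⁻¹ * A⁻¹) * B *
      ((M - M⁻¹) * (A * A * M * q - A⁻¹ * A⁻¹ * M⁻¹ * q⁻¹)) + A⁻¹ * (A⁻¹ * A⁻¹ * N) =
      A * N⁻¹ - (N * q - (N * q)⁻¹)⁻¹ * (B * A⁻¹ * N * q) * (B⁻¹ * N⁻¹ * q⁻¹) *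
        ((M * N * q - M⁻¹ * N⁻¹ * q⁻¹) * (A * A * M * N⁻¹ - A⁻¹ * A⁻¹ * M⁻¹ * N)) := by
    have h2' : N ^ 2 * q ^ 2 - 1 ≠ 0 := fun e => h2 (by field_simp; linear_combination e)
    have : (N * q - (N * q)⁻¹)⁻¹ = (N * q) * (N ^ 2 * q ^ 2 - 1)⁻¹ := by
      field_simp
    rw [this]
    field_simp
    ring
  have k1 : N⁻¹ * q⁻¹ = (N * q)⁻¹ := by rw [mul_inv]
  have k2 : ((q⁻¹ - q) : ℂ) = -(q - q⁻¹) := by ring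
  generalize hD : (N * q - (N * q)⁻¹) = D at *
  generalize q - q⁻¹ = d at *
  have k3 : N * q - N⁻¹ * q⁻¹ = D := by rw [k1, hD]
  rw [k2, k3]
  have f₁ := braid_frac T (G * (B⁻¹ * A⁻¹)) Q D P h3 (u := M - M⁻¹)
    (v := A * A * M * q - A⁻¹ * A⁻¹ * M⁻¹ * q⁻¹)
  have f₂ := braid_frac T (G * (B * A⁻¹ * N * q)) Q D P h3 (u := M * N * q - M⁻¹ * N⁻¹ * q⁻¹)
    (v := A * A * M * N⁻¹ - A⁻¹ * A⁻¹ * M⁻¹ * N)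
  linear_combination (T * G * P / Q) * key + B * f₁ - B⁻¹ * N⁻¹ * q⁻¹ * f₂ -
    A⁻¹ * (T * (G * (A⁻¹ * A⁻¹ * N)) / Q) * p1 + (T * G / Q) * (A * N⁻¹) * p2

end Braiding

/-! ### The braiding as an injective homomorphism and its scalars -/

section Braiding

variable {h : ℂ}

/-- The braiding `M_l ⊗ M_μ → M_μ ⊗ M_l`. -/
def braid (h l μ : ℂ) : Verma ⊗[ℂ] Verma →ₗ[ℂ] Verma ⊗[ℂ] Verma :=
  TensorProduct.lift <| Finsupp.linearCombination ℂ fun i : ℕ =>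
    Finsupp.linearCombination ℂ fun m : ℕ =>
      ∑ n ∈ Finset.range (m + 1), braidCoeff h μ (l - i) m n • (vec (m - n) ⊗ₜ[ℂ] vec (i + n))

theorem braid_vec (h l μ : ℂ) (i m : ℕ) :
    braid h l μ (vec i ⊗ₜ vec m) = ∑ n ∈ Finset.range (m + 1),
      braidCoeff h μ (l - i) m n • (vec (m - n) ⊗ₜ[ℂ] vec (i + n)) := by
  rw [braid, TensorProduct.lift.tmul, verma_lin, verma_lin]

theorem coF_vec_tmul (h l₁ l₂ : ℂ) (i k : ℕ) :
    coF h l₁ l₂ (vec i ⊗ₜ[ℂ] vec k) = qpow h (l₂ - k) • (vec (i + 1) ⊗ₜ[ℂ] vec k) +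
      qpow h (-(l₁ - i)) • (vec i ⊗ₜ[ℂ] vec (k + 1)) := by
  simp only [coF, LinearMap.add_apply, TensorProduct.map_tmul, opF_vec, opK_vec, opKinv_vec,
    TensorProduct.tmul_smul, ← TensorProduct.smul_tmul']

theorem braid_coF (hq : NotRootOfUnity h) (l μ : ℂ) :
    braid h l μ ∘ₗ coF h l μ = coF h μ l ∘ₗ braid h l μ := by
  refine verma₂_ext fun i m => ?_
  simp only [LinearMap.comp_apply, coF_vec_tmul, map_add, map_smul, braid_vec, map_sum]
  have hR : ∀ n ∈ Finset.range (m + 1),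
      braidCoeff h μ (l - i) m n • (qpow h (l - (i + n : ℕ)) • (vec (m - n + 1) ⊗ₜ[ℂ] vec (i + n)) +
        qpow h (-(μ - (m - n : ℕ))) • (vec (m - n) ⊗ₜ[ℂ] vec (i + n + 1))) =
      (braidCoeff h μ (l - i) m n * qpow h (l - i - n)) • (vec (m + 1 - n) ⊗ₜ[ℂ] vec (i + n)) +
      (braidCoeff h μ (l - i) m n * qpow h (-(μ - m + n))) •
        (vec (m + 1 - (n + 1)) ⊗ₜ[ℂ] vec (i + (n + 1))) := by
    intro n hn
    have hn : n ≤ m := by have := Finset.mem_range.mp hn; omega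
    rw [smul_add, smul_smul, smul_smul, Nat.cast_sub hn, show m - n + 1 = m + 1 - n by omega,
      Nat.add_sub_add_right, add_assoc i n 1]
    congr 3
    · congr 1; push_cast; ring
    · congr 1; ring
  rw [Finset.sum_congr rfl hR, Finset.sum_add_distrib]
  -- The added term n = m + 1 is zero, and makes the ranges on both sides agree.
  have hR' := Finset.sum_range_succ (fun n : ℕ => (braidCoeff h μ (l - i) m n *
    qpow h (l - i - n)) • (vec (m + 1 - n) ⊗ₜ[ℂ] vec (i + n))) (m + 1)
  rw [braidCoeff_eq_zero h μ _ (Nat.lt_succ_self m), zero_mul, zero_smul, add_zero] at hR'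
  rw [← hR', Finset.sum_range_succ' _ (m + 1), Finset.sum_range_succ' _ (m + 1), smul_add, Finset.smul_sum,
    Finset.smul_sum, add_right_comm _ _ (Finset.sum _ _), ← add_assoc, ← Finset.sum_add_distrib,
    ← Finset.sum_add_distrib]
  congr 1
  · refine Finset.sum_congr rfl fun n _ => ?_
    have := braidCoeff_F hq μ (l - i) m n
    rw [show l - ((i + 1 : ℕ) : ℂ) = l - i - 1 by push_cast; ring, ← add_smul, ← this, add_smul,
      smul_smul, smul_smul, show i + 1 + n = i + (n + 1) by omega, Nat.add_sub_add_right]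
  · rw [smul_smul, braidCoeff_zero, braidCoeff_zero, ← qpow_add, ← qpow_add]
    congr 2; push_cast; ring

theorem braid_coE (hq : NotRootOfUnity h) (l μ : ℂ) :
    braid h l μ ∘ₗ coE h l μ = coE h μ l ∘ₗ braid h l μ := by
  refine verma₂_ext fun i m => ?_
  simp only [LinearMap.comp_apply, coE_vec_tmul, map_add, map_smul]
  have hL : (qnum h i * qnum h (2 * l - i + 1) * qpow h (μ - m)) •
      braid h l μ (vec (i - 1) ⊗ₜ vec m) = ∑ n ∈ Finset.range (m + 1),
        (qnum h i * qnum h (2 * l - i + 1) * qpow h (μ - m) * braidCoeff h μ (l - i + 1) m n) •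
          (vec (m - n) ⊗ₜ[ℂ] vec (i + n - 1)) := by
    rcases i with - | i
    · simp [qnum_zero]
    · rw [braid_vec, Finset.smul_sum]
      refine Finset.sum_congr rfl fun n _ => ?_
      rw [smul_smul, Nat.add_sub_cancel, show i + 1 + n - 1 = i + n by omega,
        show l - ((i + 1 : ℕ) : ℂ) + 1 = l - i by push_cast; ring]
  rw [hL]
  conv_rhs => rw [braid_vec, map_sum]
  simp only [map_smul, coE_vec_tmul, smul_add, Finset.sum_add_distrib, smul_smul]
  rw [Finset.sum_range_succ', Finset.sum_range_succ, Finset.sum_range_succ' _ m]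
  have h0 : qnum h i * qnum h (2 * l - i + 1) * qpow h (μ - m) * braidCoeff h μ (l - i + 1) m 0 =
      braidCoeff h μ (l - i) m 0 * (qpow h (-(μ - (m - 0 : ℕ))) *
        (qnum h (i + 0 : ℕ) * qnum h (2 * l - (i + 0 : ℕ) + 1))) := by
    have : qpow h (μ - m) * qpow h (-2 * (l - i + 1) * (μ - m)) =
        qpow h (-2 * (l - i) * (μ - m)) * qpow h (-(μ - m)) := by
      rw [← qpow_add, ← qpow_add]
      congr 1; ring
    rw [braidCoeff_zero, braidCoeff_zero, Nat.sub_zero, Nat.add_zero]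
    linear_combination (qnum h i * qnum h (2 * l - i + 1)) * this
  rw [h0, add_right_comm, ← add_assoc, Nat.sub_self, Nat.cast_zero, qnum_zero]
  simp only [zero_mul, mul_zero, zero_smul, add_zero]
  congr 1
  rcases m with - | m
  · simp [qnum_zero]
  rw [braid_vec, show m + 1 - 1 = m from rfl, Finset.smul_sum, ← Finset.sum_add_distrib,
    ← Finset.sum_add_distrib]
  refine Finset.sum_congr rfl fun n hn => ?_
  have hn : n ≤ m := by have := Finset.mem_range.mp hn; omega
  have key := braidCoeff_E hq μ l i m n
  rw [Nat.add_sub_add_right, show i + (n + 1) - 1 = i + n by omega,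
    show m + 1 - n - 1 = m - n by omega, smul_smul, ← add_smul, ← add_smul]
  congr 1
  rw [Nat.cast_sub (by omega : n ≤ m + 1), Nat.cast_sub hn,
    show (2 * μ - (((m + 1 : ℕ) : ℂ) - n) + 1) = 2 * μ - (m + 1 : ℕ) + n + 1 by ring,
    show l - ((i + n : ℕ) : ℂ) = l - i - n by push_cast; ring,
    show μ - ((m : ℂ) - n) = μ - (m + 1 : ℕ) + (n + 1 : ℕ) by push_cast; ring]
  exact key

theorem braid_isHom (hq : NotRootOfUnity h) (l μ : ℂ) :
    (verma₂ h l μ).IsHom (verma₂ h μ l) (braid h l μ) where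
  E := braid_coE hq l μ
  F := braid_coF hq l μ
  K := by
    refine verma₂_ext fun i m => ?_
    simp only [LinearMap.comp_apply, Ops.tensor, verma, TensorProduct.map_tmul, opK_vec,
      TensorProduct.smul_tmul_smul, map_smul, braid_vec, map_sum, Finset.smul_sum, ← qpow_add]
    refine Finset.sum_congr rfl fun n hn => ?_
    have hn : n ≤ m := by have := Finset.mem_range.mp hn; omega
    rw [smul_comm, Nat.cast_sub hn]
    congr 3; push_cast; ring
  L := by
    refine verma₂_ext fun i m => ?_
    simp only [LinearMap.comp_apply, Ops.tensor, verma, TensorProduct.map_tmul, opKinv_vec,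
      TensorProduct.smul_tmul_smul, map_smul, braid_vec, map_sum, Finset.smul_sum, ← qpow_add]
    refine Finset.sum_congr rfl fun n hn => ?_
    have hn : n ≤ m := by have := Finset.mem_range.mp hn; omega
    rw [smul_comm, Nat.cast_sub hn]
    congr 3; push_cast; ring
  H := by
    refine verma₂_ext fun i m => ?_
    simp only [LinearMap.comp_apply, Ops.tensor, verma, LinearMap.add_apply,
      TensorProduct.map_tmul, opH_vec, LinearMap.id_apply, ← TensorProduct.smul_tmul',
      TensorProduct.tmul_smul, ← add_smul, map_smul, braid_vec, map_sum, Finset.smul_sum]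
    refine Finset.sum_congr rfl fun n hn => ?_
    have hn : n ≤ m := by have := Finset.mem_range.mp hn; omega
    rw [smul_comm, Nat.cast_sub hn]
    congr 2; push_cast; ring

theorem coord_braid (h l μ : ℂ) (p r : ℕ) (x : Verma ⊗[ℂ] Verma) :
    coord p r (braid h l μ x) = ∑ n ∈ Finset.range (r + 1),
      braidCoeff h μ (l - (r - n : ℕ)) (p + n) n * coord (r - n) (p + n) x := by
  suffices e : coord p r ∘ₗ braid h l μ = ∑ n ∈ Finset.range (r + 1),
      braidCoeff h μ (l - (r - n : ℕ)) (p + n) n • coord (r - n) (p + n) by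
    have := LinearMap.congr_fun e x
    simpa only [LinearMap.comp_apply, LinearMap.sum_apply, LinearMap.smul_apply, smul_eq_mul] using this
  refine verma₂_ext fun i m => ?_
  rw [LinearMap.comp_apply, braid_vec, map_sum, LinearMap.sum_apply]
  simp only [LinearMap.smul_apply, map_smul, coord_vec]
  by_cases hex : ∃ n, r = i + n ∧ m = p + n
  · obtain ⟨n, rfl, rfl⟩ := hex
    rw [Finset.sum_eq_single n, Finset.sum_eq_single n]
    · simp
    · intro k hk hkn
      rw [Finset.mem_range] at hk
      rw [if_neg (by omega), smul_zero]
    · intro hn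
      rw [Finset.mem_range] at hn
      omega
    · intro k hk hkn
      rw [if_neg (by omega), smul_zero]
    · intro hn
      rw [Finset.mem_range] at hn
      omega
  · rw [Finset.sum_eq_zero, Finset.sum_eq_zero]
    · intro n hn
      rw [Finset.mem_range] at hn
      rw [if_neg (fun e => hex ⟨n, by omega, by omega⟩), smul_zero]
    · intro n hn
      rw [Finset.mem_range] at hn
      rw [if_neg (fun e => hex ⟨n, by omega, by omega⟩), smul_zero]

/-- The braiding is triangular: its coordinate (p, r) is an invertible multiple of the coordinate
(r, p) of x plus terms whose first index is smaller than r. -/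
theorem braid_injective (h l μ : ℂ) : Function.Injective (braid h l μ) := by
  intro x y hxy
  refine eq_of_coord fun r => ?_
  induction r using Nat.strong_induction_on with
  | _ r ih =>
    intro p
    have := congrArg (coord p r) hxy
    rw [coord_braid, coord_braid, Finset.sum_range_succ', Finset.sum_range_succ'] at this
    rw [Finset.sum_congr rfl fun n hn => by rw [ih (r - (n + 1)) (by
      have := Finset.mem_range.mp hn; omega)], add_right_inj, braidCoeff_zero] at this
    exact mul_left_cancel₀ (qpow_ne_zero _ _) this

/-- A linear left inverse suffices later; it need not be known to be a homomorphism. -/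
theorem exists_braid_leftInverse (h l μ : ℂ) :
    ∃ C : Verma ⊗[ℂ] Verma →ₗ[ℂ] Verma ⊗[ℂ] Verma, C ∘ₗ braid h l μ = LinearMap.id :=
  @LinearMap.exists_leftInverse_of_injective ℂ (Verma ⊗[ℂ] Verma) (Verma ⊗[ℂ] Verma) _ _ _ _ _
    (braid h l μ) (LinearMap.ker_eq_bot_of_injective (braid_injective h l μ))

/-- The scalar by which the braiding acts on a summand of a tensor product. -/
def braidPhase (h x y z : ℂ) : ℂ :=
  (-1) ^ (x + y - z) * qpow h (x * (x + 1) + y * (y + 1) - z * (z + 1))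

theorem Delta_comm (h x y z : ℂ) : Delta h x y z = Delta h y x z := by
  rw [Delta, Delta, show gap x y z = gap y x z by rw [gap, gap, add_comm x y],
    mul_comm (qfall h (2 * x) _)]

/-- The scalar is read at the coordinate (n, 0), where only the diagonal term of the `R`-matrix
contributes. It compares the two end coefficients of the highest weight vectors; as `Delta` is
symmetric, the chosen normalisation leaves a sign and a power of q. -/
theorem braid_emb (hq : NotRootOfUnity h) {l μ L : ℂ} (g₁ : IsGeneric h l) (g₂ : IsGeneric h μ)
    (g : IsGeneric h L) (ha : Adm l μ L) :
    braid h l μ ∘ₗ emb h l μ L = braidPhase h l μ L • emb h μ l L := by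
  have hφ := (braid_isHom hq l μ).comp (emb_isHom hq g₁ g₂ ha)
  obtain ⟨n, hn⟩ := ha
  rw [hom_eq_smul_emb hq g₂ g₁ g hφ (n := n) (by rw [add_comm μ, hn])]
  congr 1
  rw [div_eq_iff (mul_ne_zero (Delta_ne_zero hq g₂ g₁ g) (hwCoeff_ne_zero hq g₂ g₁ n 0)),
    LinearMap.comp_apply, emb_vec_zero, coord_braid, zero_add, Finset.sum_range_one,
    Nat.sub_zero, Nat.add_zero, coord_hwVec h hn, if_pos (zero_add n), braidCoeff_zero,
    Nat.cast_zero, Delta_comm h μ l, braidPhase, hn, Complex.cpow_natCast, hwCoeff, hwCoeff,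
    Nat.sub_self, Nat.sub_zero]
  have h0 : qfact h 0 = 1 := rfl
  have h1 : ∀ x, qfall h x 0 = 1 := fun x => rfl
  obtain rfl : L = l + μ - n := by linear_combination -hn
  have e : qpow h (-2 * (l - 0) * (μ - n)) *
      qpow h (n * (l + μ - n + 1) - n * (2 * l - n + 1) / 2) =
      qpow h (l * (l + 1) + μ * (μ + 1) - (l + μ - n) * (l + μ - n + 1)) *
        qpow h ((0 : ℕ) * (μ + l - n + 1) - n * (2 * μ - n + 1) / 2) := by
    rw [← qpow_add, ← qpow_add]
    congr 1; push_cast; ring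
  rw [h0, h1, pow_zero]
  linear_combination (Delta h l μ (l + μ - n) * (-1) ^ n /
    (qfact h n * 1 * qfall h (2 * μ) n * 1)) * e

end Braiding

/-! ### Powers of the coproduct of `F` and the hexagon relation -/

section Hexagon

variable {h : ℂ}

/-- The coefficients of the powers of `F` on a tensor product of Verma modules. -/
def powCoeff (h a b : ℂ) (r n : ℕ) : ℂ :=
  qfact h (r + n) / (qfact h r * qfact h n) * qpow h (r * b - n * a)

theorem qnum_add (h x y : ℂ) :
    qnum h (x + y) = qnum h x * qpow h (-y) + qpow h x * qnum h y := by
  simp only [qnum, qpow_add, qpow_neg, neg_add]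
  have := qpow_ne_zero h x
  have := qpow_ne_zero h y
  ring

theorem powCoeff_zero_left (hq : NotRootOfUnity h) (a b : ℂ) (n : ℕ) :
    powCoeff h a b 0 n = qpow h (-n * a) := by
  have h0 : qfact h 0 = 1 := rfl
  rw [powCoeff, zero_add, h0, one_mul, div_self (hq.qfact_ne_zero n), one_mul]
  congr 1; push_cast; ring

theorem powCoeff_zero_right (hq : NotRootOfUnity h) (a b : ℂ) (r : ℕ) :
    powCoeff h a b r 0 = qpow h (r * b) := by
  have h0 : qfact h 0 = 1 := rfl
  rw [powCoeff, add_zero, h0, mul_one, div_self (hq.qfact_ne_zero r), one_mul]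
  congr 1; push_cast; ring

/-- The q-Pascal rule, from [r+n+2] = [r+1] q^(-(n+1)) + q^(r+1) [n+1]. -/
theorem powCoeff_succ_succ (hq : NotRootOfUnity h) (a b : ℂ) (r n : ℕ) :
    powCoeff h a b (r + 1) (n + 1) = powCoeff h a b r (n + 1) * qpow h (b - (n + 1 : ℕ)) +
      powCoeff h a b (r + 1) n * qpow h (-(a - (r + 1 : ℕ))) := by
  have e1 : qpow h ((r : ℕ) * b - (n + 1 : ℕ) * a) * qpow h (b - (n + 1 : ℕ)) =
      qpow h ((r + 1 : ℕ) * b - (n + 1 : ℕ) * a) * qpow h (-((n : ℂ) + 1)) := by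
    rw [← qpow_add, ← qpow_add]; congr 1; push_cast; ring
  have e2 : qpow h ((r + 1 : ℕ) * b - (n : ℕ) * a) * qpow h (-(a - (r + 1 : ℕ))) =
      qpow h ((r + 1 : ℕ) * b - (n + 1 : ℕ) * a) * qpow h ((r : ℂ) + 1) := by
    rw [← qpow_add, ← qpow_add]; congr 1; push_cast; ring
  have e3 := qnum_add h ((r : ℂ) + 1) ((n : ℂ) + 1)
  rw [powCoeff, powCoeff, powCoeff, mul_assoc _ _ (qpow h (b - _)), e1,
    mul_assoc _ _ (qpow h (-(a - _))), e2, show r + 1 + (n + 1) = r + n + 1 + 1 by omega,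
    show r + (n + 1) = r + n + 1 by omega, show r + 1 + n = r + n + 1 by omega,
    qfact_succ h (r + n + 1), qfact_succ h r, qfact_succ h n,
    show ((r + n + 1 : ℕ) : ℂ) + 1 = r + 1 + (n + 1) by push_cast; ring, e3]
  have h1 := hq.qfact_ne_zero r
  have h2 := hq.qfact_ne_zero n
  have h3 := hq.qnum_ne_zero r
  have h4 := hq.qnum_ne_zero n
  generalize qfact h r = R at *
  generalize qfact h n = N at *
  generalize qnum h ((r : ℂ) + 1) = x at *
  generalize qnum h ((n : ℂ) + 1) = y at *
  generalize qpow h (-((n : ℂ) + 1)) = u at *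
  generalize qpow h ((r : ℂ) + 1) = v at *
  field_simp

/-- The q-binomial theorem for the two q-commuting summands of the coproduct of `F`. -/
theorem coF_pow_vec (hq : NotRootOfUnity h) (l₁ l₂ : ℂ) (i j N : ℕ) :
    (coF h l₁ l₂ ^ N) (vec i ⊗ₜ vec j) = ∑ n ∈ Finset.range (N + 1),
      powCoeff h (l₁ - i) (l₂ - j) (N - n) n • (vec (i + (N - n)) ⊗ₜ[ℂ] vec (j + n)) := by
  induction N with
  | zero => simp [powCoeff_zero_left hq, qpow_zero]
  | succ N ih =>
    rw [pow_succ', Module.End.mul_apply, ih, map_sum]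
    simp only [map_smul, coF_vec_tmul, smul_add, smul_smul, Finset.sum_add_distrib]
    rw [Finset.sum_range_succ' _ N, Finset.sum_range_succ _ N, Finset.sum_range_succ' _ (N + 1),
      Finset.sum_range_succ _ N, add_add_add_comm, add_comm (_ • _) (_ • _), ← add_assoc,
      ← Finset.sum_add_distrib]
    congr 1
    · congr 1
      · refine Finset.sum_congr rfl fun n hn => ?_
        obtain ⟨r, rfl⟩ : ∃ r, N = r + n + 1 := ⟨N - n - 1, by
          have := Finset.mem_range.mp hn; omega⟩
        rw [show r + n + 1 - (n + 1) = r by omega, show r + n + 1 - n = r + 1 by omega,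
          show r + n + 1 + 1 - (n + 1) = r + 1 by omega, powCoeff_succ_succ hq, add_smul]
        congr 3
        · congr 1; push_cast; ring
        · congr 1; push_cast; ring
      · rw [Nat.sub_self, Nat.sub_self, powCoeff_zero_left hq, powCoeff_zero_left hq, ← qpow_add]
        congr 2; push_cast; ring
    · rw [Nat.sub_zero, Nat.sub_zero, powCoeff_zero_right hq, powCoeff_zero_right hq, ← qpow_add]
      congr 2; push_cast; ring

/-- The coefficient form of the `R`-matrix law for a coproduct in one argument: two successive
braidings give one braiding at the total weight, times a q-binomial coefficient. -/
theorem braidCoeff_mul (hq : NotRootOfUnity h) (μ a b : ℂ) {m n : ℕ} (hn : n ≤ m) (r : ℕ) :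
    braidCoeff h μ b m n * braidCoeff h μ a (m - n) r =
      braidCoeff h μ (a + b) m (r + n) * powCoeff h a b r n := by
  have e : braidExp h b (μ - m) n * braidExp h a (μ - (m - n : ℕ)) r =
      braidExp h (a + b) (μ - m) (r + n) * qpow h (r * b - n * a) := by
    rw [braidExp, braidExp, braidExp, ← qpow_add, ← qpow_add, Nat.cast_sub hn]
    congr 1; push_cast; ring
  have h1 := hq.qfact_ne_zero (r + n)
  simp only [braidCoeff, powCoeff]
  rw [add_comm r n, raise_add h μ hn, pow_add, add_comm n r]
  generalize raise h μ m n = R₁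
  generalize raise h μ _ r = R₂
  generalize qpow h (-1) - qpow h 1 = d
  calc _ = d ^ n * d ^ r * (R₁ * R₂) / (qfact h n * qfact h r) *
        (braidExp h b (μ - m) n * braidExp h a (μ - (m - n : ℕ)) r) := by ring
    _ = _ := by
      rw [e]
      field_simp

/-- An operator on the first two factors of `M ⊗ (M ⊗ U)`. -/
def onLeft (C : Verma ⊗[ℂ] Verma →ₗ[ℂ] Verma ⊗[ℂ] Verma) (U : Type) [AddCommMonoid U]
    [Module ℂ U] : Verma ⊗[ℂ] (Verma ⊗[ℂ] U) →ₗ[ℂ] Verma ⊗[ℂ] (Verma ⊗[ℂ] U) :=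
  (TensorProduct.assoc ℂ Verma Verma U).toLinearMap ∘ₗ TensorProduct.map C LinearMap.id ∘ₗ
    (TensorProduct.assoc ℂ Verma Verma U).symm.toLinearMap

theorem onLeft_tmul (C : Verma ⊗[ℂ] Verma →ₗ[ℂ] Verma ⊗[ℂ] Verma) {U : Type} [AddCommMonoid U]
    [Module ℂ U] (a b : Verma) (u : U) : onLeft C U (a ⊗ₜ (b ⊗ₜ u)) =
      TensorProduct.assoc ℂ Verma Verma U (C (a ⊗ₜ b) ⊗ₜ u) := by
  simp [onLeft]

theorem hexagon_vec (hq : NotRootOfUnity h) (l₁ l₂ μ : ℂ) (j k m : ℕ) :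
    onLeft (braid h l₁ μ) Verma (vec j ⊗ₜ braid h l₂ μ (vec k ⊗ₜ vec m)) =
      ∑ n ∈ Finset.range (m + 1), braidCoeff h μ (l₁ - j + (l₂ - k)) m n •
        (vec (m - n) ⊗ₜ (coF h l₁ l₂ ^ n) (vec j ⊗ₜ vec k)) := by
  simp only [coF_pow_vec hq, TensorProduct.tmul_sum, TensorProduct.tmul_smul, Finset.smul_sum,
    smul_smul, braid_vec, map_sum, map_smul, onLeft_tmul, TensorProduct.sum_tmul,
    ← TensorProduct.smul_tmul', TensorProduct.assoc_tmul]
  -- The double sum is regrouped by the total power N = r + n of `F`.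
  have := Finset.sum_range_diag_flip (m + 1) (fun n r : ℕ =>
    (braidCoeff h μ (l₁ - j + (l₂ - k)) m (r + n) * powCoeff h (l₁ - j) (l₂ - k) r n) •
      (vec (m - (r + n)) ⊗ₜ[ℂ] (vec (j + r) ⊗ₜ[ℂ] vec (k + n))))
  calc _ = _ := Finset.sum_congr rfl fun n hn => ?_
    _ = _ := this.symm
    _ = _ := Finset.sum_congr rfl fun N hN => Finset.sum_congr rfl fun n hn => ?_
  · have hn : n ≤ m := by have := Finset.mem_range.mp hn; omega
    rw [show m + 1 - n = m - n + 1 by omega]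
    refine Finset.sum_congr rfl fun r hr => ?_
    rw [braidCoeff_mul hq _ _ _ hn, show m - n - r = m - (r + n) by omega]
  · have hn : n ≤ N := by have := Finset.mem_range.mp hn; omega
    rw [Nat.sub_add_cancel hn]

theorem eq_sum_coord (x : Verma ⊗[ℂ] Verma) : ∃ s : Finset (ℕ × ℕ),
    x = ∑ p ∈ s, coord p.1 p.2 x • (vec p.1 ⊗ₜ[ℂ] vec p.2) := by
  refine ⟨(finsuppTensorFinsupp' ℂ ℕ ℕ x).support, eq_of_coord fun i j => ?_⟩
  rw [map_sum]
  simp only [map_smul, coord_vec, smul_eq_mul, mul_ite, mul_one, mul_zero]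
  by_cases hij : (i, j) ∈ (finsuppTensorFinsupp' ℂ ℕ ℕ x).support
  · rw [Finset.sum_eq_single (i, j)]
    · simp
    · rintro ⟨a, b⟩ _ hp
      rw [if_neg (fun e => hp (Prod.ext e.1 e.2))]
    · exact fun e => absurd hij e
  · rw [Finset.sum_eq_zero]
    · exact Finsupp.notMem_support_iff.mp hij
    · rintro ⟨a, b⟩ hp
      rw [if_neg]
      rintro ⟨rfl, rfl⟩
      exact hij hp

/-- The coefficients in `hexagon_vec` depend on j and k only through the total weight, which is l -
i on every term of the image of `vec i`. So they leave the sum, and powers of `F` pass through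
`emb`. -/
theorem hexagon (hq : NotRootOfUnity h) {l₁ l₂ l : ℂ} (μ : ℂ) (g₁ : IsGeneric h l₁)
    (g₂ : IsGeneric h l₂) (ha : Adm l₁ l₂ l) :
    onLeft (braid h l₁ μ) Verma ∘ₗ TensorProduct.map LinearMap.id (braid h l₂ μ) ∘ₗ
        (TensorProduct.assoc ℂ Verma Verma Verma).toLinearMap ∘ₗ
        TensorProduct.map (emb h l₁ l₂ l) LinearMap.id =
      TensorProduct.map LinearMap.id (emb h l₁ l₂ l) ∘ₗ braid h l μ := by
  refine verma₂_ext fun i m => ?_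
  have hF : ∀ n : ℕ, emb h l₁ l₂ l (vec (i + n)) =
      (coF h l₁ l₂ ^ n) (emb h l₁ l₂ l (vec i)) := fun n => by
    rw [emb_vec, emb_vec, ← Module.End.mul_apply, ← pow_add, add_comm]
  have hH := (emb_isHom hq g₁ g₂ ha).H_vec i
  simp only [LinearMap.comp_apply, TensorProduct.map_tmul, LinearMap.id_apply, braid_vec, map_sum,
    map_smul, hF, LinearEquiv.coe_coe]
  generalize emb h l₁ l₂ l (vec i) = x at *
  have key : ∀ j k : ℕ, coord j k x •
      onLeft (braid h l₁ μ) Verma (vec j ⊗ₜ braid h l₂ μ (vec k ⊗ₜ vec m)) =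
      coord j k x • ∑ n ∈ Finset.range (m + 1), braidCoeff h μ (l - i) m n •
        (vec (m - n) ⊗ₜ (coF h l₁ l₂ ^ n) (vec j ⊗ₜ vec k)) := fun j k => by
    by_cases e : l₁ - j + (l₂ - k) = l - i
    · rw [hexagon_vec hq, e]
    · rw [coord_eq_zero_of_H hH e, zero_smul, zero_smul]
  obtain ⟨s, hs⟩ := eq_sum_coord x
  -- The coefficients are made opaque so that rewriting x by its expansion leaves them alone.
  generalize hc : (fun j k => coord j k x) = c at *
  have hc' : ∀ j k, coord j k x = c j k := fun j k => by rw [← hc]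
  simp only [hc'] at hs key
  rw [hs]
  simp only [TensorProduct.sum_tmul, ← TensorProduct.smul_tmul', map_sum, map_smul,
    TensorProduct.assoc_tmul, TensorProduct.map_tmul, LinearMap.id_apply, key,
    TensorProduct.tmul_sum, TensorProduct.tmul_smul, Finset.smul_sum]
  rw [Finset.sum_comm]
  refine Finset.sum_congr rfl fun n _ => Finset.sum_congr rfl fun p _ => ?_
  rw [smul_comm]

end Hexagon

/-! ### Reassociation, and recoupling combined with braiding -/

section YangBaxter

variable {h : ℂ}

section Reassociation

variable {U U' : Type} [AddCommMonoid U] [Module ℂ U] [AddCommMonoid U'] [Module ℂ U']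

theorem onLeft_comp_onLeft (C D : Verma ⊗[ℂ] Verma →ₗ[ℂ] Verma ⊗[ℂ] Verma) :
    onLeft C U ∘ₗ onLeft D U = onLeft (C ∘ₗ D) U := by
  refine LinearMap.ext fun x => ?_
  simp only [onLeft, LinearMap.comp_apply, LinearEquiv.coe_coe, LinearEquiv.symm_apply_apply]
  rw [← LinearMap.comp_apply (TensorProduct.map C LinearMap.id), ← TensorProduct.map_comp,
    LinearMap.id_comp]

theorem onLeft_id : onLeft LinearMap.id U = LinearMap.id := by
  refine LinearMap.ext fun x => ?_
  simp [onLeft]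

theorem onLeft_naturality (C : Verma ⊗[ℂ] Verma →ₗ[ℂ] Verma ⊗[ℂ] Verma) (f : U →ₗ[ℂ] U') :
    TensorProduct.map LinearMap.id (TensorProduct.map LinearMap.id f) ∘ₗ onLeft C U =
      onLeft C U' ∘ₗ TensorProduct.map LinearMap.id (TensorProduct.map LinearMap.id f) := by
  refine TensorProduct.ext' fun a y => ?_
  induction y using TensorProduct.induction_on with
  | zero => simp
  | add y z hy hz => rw [TensorProduct.tmul_add, map_add, map_add, hy, hz]
  | tmul b u =>
    simp only [LinearMap.comp_apply, TensorProduct.map_tmul, LinearMap.id_apply, onLeft_tmul]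
    generalize C (a ⊗ₜ b) = z
    induction z using TensorProduct.induction_on with
    | zero => simp
    | add y z hy hz => simp only [TensorProduct.add_tmul, map_add, hy, hz]
    | tmul c d => simp

/-- The reassociation `(U ⊗ (V ⊗ V)) ⊗ V → U ⊗ (V ⊗ (V ⊗ V))`. -/
def reassoc : (Verma ⊗[ℂ] (Verma ⊗[ℂ] Verma)) ⊗[ℂ] Verma →ₗ[ℂ]
    Verma ⊗[ℂ] (Verma ⊗[ℂ] (Verma ⊗[ℂ] Verma)) :=
  TensorProduct.map LinearMap.id (TensorProduct.assoc ℂ Verma Verma Verma).toLinearMap ∘ₗ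
    (TensorProduct.assoc ℂ Verma (Verma ⊗[ℂ] Verma) Verma).toLinearMap

theorem reassoc_tmul (a : Verma) (y : Verma ⊗[ℂ] Verma) (b : Verma) :
    reassoc ((a ⊗ₜ y) ⊗ₜ b) = a ⊗ₜ TensorProduct.assoc ℂ Verma Verma Verma (y ⊗ₜ b) := by
  simp [reassoc]

/-- `C` acts on the first two of four factors, so it commutes with rebracketing the last one. -/
theorem onLeft_reassoc (C : Verma ⊗[ℂ] Verma →ₗ[ℂ] Verma ⊗[ℂ] Verma)
    (f : Verma →ₗ[ℂ] Verma ⊗[ℂ] Verma) :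
    onLeft C (Verma ⊗[ℂ] Verma) ∘ₗ TensorProduct.map LinearMap.id
        ((TensorProduct.assoc ℂ Verma Verma Verma).toLinearMap ∘ₗ
          TensorProduct.map f LinearMap.id) ∘ₗ
        (TensorProduct.assoc ℂ Verma Verma Verma).toLinearMap =
      reassoc ∘ₗ TensorProduct.map (onLeft C Verma ∘ₗ TensorProduct.map LinearMap.id f)
        LinearMap.id := by
  refine TensorProduct.ext_threefold fun a b c => ?_
  simp only [LinearMap.comp_apply, TensorProduct.map_tmul, LinearMap.id_apply,
    LinearEquiv.coe_coe, TensorProduct.assoc_tmul]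
  generalize f b = y
  induction y using TensorProduct.induction_on with
  | zero => simp
  | add y z hy hz =>
    simp only [TensorProduct.add_tmul, TensorProduct.tmul_add, map_add, hy, hz]
  | tmul y₁ y₂ =>
    simp only [TensorProduct.assoc_tmul, onLeft_tmul]
    generalize C (a ⊗ₜ y₁) = z
    induction z using TensorProduct.induction_on with
    | zero => simp
    | add y z hy hz => simp only [TensorProduct.add_tmul, map_add, hy, hz]
    | tmul z₁ z₂ => simp only [TensorProduct.assoc_tmul, reassoc_tmul]

theorem reassoc_map (f : Verma →ₗ[ℂ] Verma ⊗[ℂ] Verma) :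
    reassoc ∘ₗ TensorProduct.map (TensorProduct.map LinearMap.id f) LinearMap.id =
      TensorProduct.map LinearMap.id ((TensorProduct.assoc ℂ Verma Verma Verma).toLinearMap ∘ₗ
        TensorProduct.map f LinearMap.id) ∘ₗ
        (TensorProduct.assoc ℂ Verma Verma Verma).toLinearMap := by
  refine TensorProduct.ext_threefold fun a b c => ?_
  simp only [LinearMap.comp_apply, TensorProduct.map_tmul, LinearMap.id_apply,
    LinearEquiv.coe_coe, TensorProduct.assoc_tmul, reassoc_tmul]

end Reassociation

theorem lTensor_comp {U V W X : Type} [AddCommMonoid U] [Module ℂ U] [AddCommMonoid V] [Module ℂ V]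
    [AddCommMonoid W] [Module ℂ W] [AddCommMonoid X] [Module ℂ X] (g : W →ₗ[ℂ] X)
    (f : V →ₗ[ℂ] W) :
    TensorProduct.map LinearMap.id (g ∘ₗ f) = (TensorProduct.map LinearMap.id g ∘ₗ
      TensorProduct.map LinearMap.id f : U ⊗[ℂ] V →ₗ[ℂ] U ⊗[ℂ] X) := by
  rw [← TensorProduct.map_comp, LinearMap.id_comp]

/-- Moving the third factor to the front after recoupling. -/
theorem sum_q6j_braidPhase (hq : NotRootOfUnity h) {a b ab c L : ℂ} (ga : IsGeneric h a)
    (gb : IsGeneric h b) (gab : IsGeneric h ab) (gc : IsGeneric h c)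
    (gbc : IsGeneric h (b + c)) (gL : IsGeneric h L) (h₁ : Adm a b ab) (h₂ : Adm ab c L) {n : ℕ}
    (hn : a + b + c - L = n) {C : Verma ⊗[ℂ] Verma →ₗ[ℂ] Verma ⊗[ℂ] Verma}
    (hC : C ∘ₗ braid h a c = LinearMap.id) :
    ∑ k ∈ Finset.range (n + 1), (q6j h a b ab c L (b + c - k) * braidPhase h b c (b + c - k)) •
        rightEmb h a c b L (b + c - k) =
      braidPhase h ab c L • (onLeft C Verma ∘ₗ TensorProduct.map LinearMap.id (emb h a b ab) ∘ₗ
        emb h c ab L) := by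
  have h1 : braidPhase h ab c L • (onLeft C Verma ∘ₗ
      TensorProduct.map LinearMap.id (emb h a b ab) ∘ₗ emb h c ab L) =
      onLeft C Verma ∘ₗ (TensorProduct.map LinearMap.id (emb h a b ab) ∘ₗ braid h ab c) ∘ₗ
        emb h ab c L := by
    rw [LinearMap.comp_assoc _ (braid h ab c), braid_emb hq gab gc gL h₂, LinearMap.comp_smul,
      LinearMap.comp_smul]
  -- Regrouping exposes `leftEmb` on the right and puts `C` next to the braiding that it cancels.
  have h2 : onLeft C Verma ∘ₗ (onLeft (braid h a c) Verma ∘ₗ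
      TensorProduct.map LinearMap.id (braid h b c) ∘ₗ
        (TensorProduct.assoc ℂ Verma Verma Verma).toLinearMap ∘ₗ
        TensorProduct.map (emb h a b ab) LinearMap.id) ∘ₗ emb h ab c L =
      (onLeft C Verma ∘ₗ onLeft (braid h a c) Verma) ∘ₗ
        TensorProduct.map LinearMap.id (braid h b c) ∘ₗ leftEmb h a b ab c L := rfl
  rw [h1, ← hexagon hq c ga gb h₁, h2, onLeft_comp_onLeft, hC, onLeft_id, LinearMap.id_comp,
    leftEmb_eq_sum hq ga gb gc gab gbc gL h₁ h₂ hn, linearMap_comp_sum]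
  refine Finset.sum_congr rfl fun k _ => ?_
  rw [LinearMap.comp_smul, mul_smul, rightEmb, rightEmb, ← LinearMap.comp_assoc, ← lTensor_comp,
    braid_emb hq gb gc (gbc.sub_natCast k) (adm_sub b c k), TensorProduct.map_smul_right,
    LinearMap.smul_comp]

theorem braidPhase_ne_zero (h x y z : ℂ) : braidPhase h x y z ≠ 0 :=
  mul_ne_zero (by rw [Ne, Complex.cpow_eq_zero_iff]; norm_num) (qpow_ne_zero _ _)

end YangBaxter

/-! ### Evaluation in the two orders, and comparison of phases -/

section Extraction

variable {h : ℂ}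

/-- The recoupling coefficients after braiding the factor `c` past its neighbours. -/
theorem extract_moved (hq : NotRootOfUnity h) {a b c d ab bd be cbd L : ℂ} (ga : IsGeneric h a)
    (gb : IsGeneric h b) (gc : IsGeneric h c) (gd : IsGeneric h d) (gab : IsGeneric h ab)
    (gbd' : IsGeneric h (b + d)) (gbd : IsGeneric h bd) (gcbd' : IsGeneric h (c + bd))
    (gbe : IsGeneric h be) (gL : IsGeneric h L) (h₁ : Adm a b ab) (h₂ : Adm ab d be)
    (h₃ : Adm be c L) (h₄ : Adm a cbd L)
    {C : Verma ⊗[ℂ] Verma →ₗ[ℂ] Verma ⊗[ℂ] Verma} (hC : C ∘ₗ braid h a c = LinearMap.id)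
    {π π' : ℕ → (Verma ⊗[ℂ] Verma →ₗ[ℂ] Verma)} (hπ : IsProj h b d π) (hπ' : IsProj h c bd π')
    {u t : ℕ} (hu : bd = b + d - u) (ht : cbd = c + bd - t) :
    TensorProduct.map LinearMap.id (π' t ∘ₗ TensorProduct.map LinearMap.id (π u)) ∘ₗ
        onLeft C (Verma ⊗[ℂ] Verma) ∘ₗ
        TensorProduct.map LinearMap.id (leftEmb h a b ab d be) ∘ₗ emb h c be L =
      (q6j h a b ab d be bd * q6j h a bd be c L cbd * braidPhase h bd c cbd /
        braidPhase h be c L) • emb h a cbd L := by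
  -- The projection onto `bd` does not touch the factors on which `C` acts, so it passes through `C`
  -- and yields the first symbol.
  have e1 : TensorProduct.map LinearMap.id (π' t ∘ₗ TensorProduct.map LinearMap.id (π u)) ∘ₗ
        onLeft C (Verma ⊗[ℂ] Verma) ∘ₗ
        TensorProduct.map LinearMap.id (leftEmb h a b ab d be) ∘ₗ emb h c be L =
      q6j h a b ab d be bd • (TensorProduct.map LinearMap.id (π' t) ∘ₗ onLeft C Verma ∘ₗ
        TensorProduct.map LinearMap.id (emb h a bd be) ∘ₗ emb h c be L) := by
    rw [lTensor_comp, LinearMap.comp_assoc, ← LinearMap.comp_assoc _ (onLeft C _),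
      onLeft_naturality, LinearMap.comp_assoc, ← LinearMap.comp_assoc (emb h c be L),
      ← lTensor_comp, hπ.proj_leftEmb hq ga gb gd gab gbd' gbe h₁ h₂ u, ← hu,
      TensorProduct.map_smul_right, LinearMap.smul_comp, LinearMap.comp_smul,
      LinearMap.comp_smul]
  rw [e1]
  by_cases h₅ : Adm a bd be
  · obtain ⟨n, hn⟩ : ∃ n : ℕ, a + bd + c - L = n := by
      obtain ⟨x, hx⟩ := h₅
      obtain ⟨y, hy⟩ := h₃
      exact ⟨x + y, by push_cast; linear_combination hx + hy⟩
    -- In the expansion of the moved factor, the second projection keeps only the term k = t, which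
    -- gives the second symbol and both phases.
    have key := congrArg (TensorProduct.map LinearMap.id (π' t) ∘ₗ ·)
      (sum_q6j_braidPhase hq ga gbd gbe gc (add_comm c bd ▸ gcbd') gL h₅ h₃ hn hC)
    have hp : ∀ k : ℕ, TensorProduct.map LinearMap.id (π' t) ∘ₗ
        rightEmb h a c bd L (bd + c - k) = if t = k then emb h a cbd L else 0 := fun k => by
      rw [rightEmb, ← LinearMap.comp_assoc, ← lTensor_comp, add_comm bd c, hπ'.proj_emb]
      split_ifs with e
      · rw [← e, ← ht, TensorProduct.map_id, LinearMap.id_comp]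
      · rw [TensorProduct.map_zero_right, LinearMap.zero_comp]
    simp only [linearMap_comp_sum, LinearMap.comp_smul, hp, smul_ite, smul_zero] at key
    rw [Finset.sum_ite_eq, if_pos, add_comm bd c, ← ht] at key
    · rw [mul_assoc (q6j h a b ab d be bd), mul_div_assoc, mul_smul, div_eq_inv_mul, mul_smul, key,
        inv_smul_smul₀ (braidPhase_ne_zero h be c L)]
    · obtain ⟨y, hy⟩ := h₄
      have : (n : ℂ) = (t + y : ℕ) := by push_cast; rw [← hn, ← hy, ht]; ring
      have : n = t + y := by exact_mod_cast this
      rw [Finset.mem_range]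
      omega
  · rw [q6j_eq_zero_of_not_adm h₅, zero_smul, zero_mul, zero_mul, zero_div, zero_smul]

/-- Recoupling `d` with `ac` gives a sum over intermediate weights ac + d - j, and the projections
keep only the weight `cbd`, that is j = N - k. For k > N that weight is out of reach, which accounts
for the conditional. -/
theorem extract_unmoved (hq : NotRootOfUnity h) {a b c d bd ac acb cbd L : ℂ}
    (ga : IsGeneric h a) (gb : IsGeneric h b) (gc : IsGeneric h c) (gd : IsGeneric h d)
    (gbd' : IsGeneric h (b + d)) (gal : IsGeneric h ac) (gacb : IsGeneric h acb)
    (gcbd : IsGeneric h cbd) (gL : IsGeneric h L) (h₁ : Adm c b ac) (h₂ : Adm a ac acb)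
    (h₃ : Adm acb d L) (h₄ : Adm a cbd L)
    {π π' : ℕ → (Verma ⊗[ℂ] Verma →ₗ[ℂ] Verma)} (hπ : IsProj h b d π) (hπ' : IsProj h c bd π')
    {u t : ℕ} (hu : bd = b + d - u) (ht : cbd = c + bd - t) {N k : ℕ} (hN : c + b + d - cbd = N)
    (hk : ac = c + b - k) :
    TensorProduct.map LinearMap.id (π' t ∘ₗ TensorProduct.map LinearMap.id (π u)) ∘ₗ
        reassoc ∘ₗ TensorProduct.map (rightEmb h a c b acb ac) LinearMap.id ∘ₗ emb h acb d L =
      (if k ≤ N then q6j h c b ac d cbd bd * q6j h a ac acb d L cbd else 0) • emb h a cbd L := by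
  have gacd : ∀ j : ℕ, IsGeneric h (ac + d - j) := fun j => by
    have := (gcbd.of_sub_natCast (l' := c + b + d) hN).sub_natCast (k + j)
    rwa [show c + b + d - ((k + j : ℕ) : ℂ) = ac + d - j by rw [hk]; push_cast; ring] at this
  have gacd' : IsGeneric h (ac + d) := by simpa using gacd 0
  obtain ⟨n, hn⟩ : ∃ n : ℕ, a + ac + d - L = n := by
    obtain ⟨x, hx⟩ := h₂
    obtain ⟨y, hy⟩ := h₃
    exact ⟨x + y, by push_cast; linear_combination hx + hy⟩
  have e1 : reassoc ∘ₗ TensorProduct.map (rightEmb h a c b acb ac) LinearMap.id ∘ₗ emb h acb d L =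
      ∑ j ∈ Finset.range (n + 1), q6j h a ac acb d L (ac + d - j) •
        (TensorProduct.map LinearMap.id (leftEmb h c b ac d (ac + d - j)) ∘ₗ
          emb h a (ac + d - j) L) := by
    have e2 : TensorProduct.map (rightEmb h a c b acb ac) (LinearMap.id : Verma →ₗ[ℂ] Verma) =
        TensorProduct.map (TensorProduct.map LinearMap.id (emb h c b ac)) LinearMap.id ∘ₗ
          TensorProduct.map (emb h a ac acb) LinearMap.id := by
      rw [← TensorProduct.map_comp, LinearMap.id_comp]
      rfl
    rw [e2, ← LinearMap.comp_assoc, ← LinearMap.comp_assoc, reassoc_map, LinearMap.comp_assoc,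
      LinearMap.comp_assoc]
    have e3 := leftEmb_eq_sum hq ga gal gd gacb gacd' gL h₂ h₃ hn
    rw [leftEmb] at e3
    rw [e3, linearMap_comp_sum]
    refine Finset.sum_congr rfl fun j _ => ?_
    rw [LinearMap.comp_smul, rightEmb, ← LinearMap.comp_assoc, ← lTensor_comp]
    rfl
  have e4 : ∀ j : ℕ, TensorProduct.map LinearMap.id
      (π' t ∘ₗ TensorProduct.map LinearMap.id (π u)) ∘ₗ
        TensorProduct.map LinearMap.id (leftEmb h c b ac d (ac + d - j)) ∘ₗ
          emb h a (ac + d - j) L =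
      if j + k = N then q6j h c b ac d cbd bd • emb h a cbd L else 0 := fun j => by
    rw [← LinearMap.comp_assoc, ← lTensor_comp, LinearMap.comp_assoc,
      hπ.proj_leftEmb hq gc gb gd gal gbd' (gacd j) h₁ (adm_sub ac d j) u, ← hu]
    by_cases hadm : Adm c bd (ac + d - j)
    · obtain ⟨s, hs⟩ := hadm
      rw [show ac + d - (j : ℂ) = c + bd - s by linear_combination -hs, LinearMap.comp_smul,
        hπ'.proj_emb]
      -- Both conditions say that the intermediate weight equals `cbd`, counted from c + bd or from
      -- c + b + d.
      have hiff : t = s ↔ j + k = N := by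
        have e : (t : ℂ) + (j + k : ℕ) = (s : ℂ) + N := by
          push_cast
          linear_combination hN + hs + ht + hk
        have e' : t + (j + k) = s + N := by exact_mod_cast e
        omega
      by_cases hts : t = s
      · rw [if_pos hts, if_pos (hiff.mp hts), ← hts, ← ht, TensorProduct.map_smul_right,
          TensorProduct.map_id, LinearMap.smul_comp, LinearMap.id_comp]
      · rw [if_neg hts, if_neg (fun e => hts (hiff.mpr e)), smul_zero,
          TensorProduct.map_zero_right, LinearMap.zero_comp]
    · rw [q6j_eq_zero_of_not_adm hadm, zero_smul, LinearMap.comp_zero,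
        TensorProduct.map_zero_right, LinearMap.zero_comp, if_neg]
      intro e
      refine hadm ⟨t, ?_⟩
      rw [← e] at hN
      push_cast at hN
      linear_combination -hN - ht - hk
  rw [e1, linearMap_comp_sum]
  simp only [LinearMap.comp_smul, e4, smul_ite, smul_zero]
  split_ifs with hkN
  · rw [Finset.sum_eq_single (N - k)]
    · rw [if_pos (Nat.sub_add_cancel hkN), smul_smul, mul_comm,
        show ac + d - ((N - k : ℕ) : ℂ) = cbd by
          rw [Nat.cast_sub hkN, ← hN, hk]; ring]
    · intro j _ hj
      rw [if_neg (by omega)]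
    · intro hj
      obtain ⟨y, hy⟩ := h₄
      have : (n : ℂ) + k = (N + y : ℕ) := by
        push_cast
        linear_combination hN + hy - hn + hk
      have : n + k = N + y := by exact_mod_cast this
      rw [Finset.mem_range] at hj
      omega
  · rw [zero_smul, Finset.sum_eq_zero]
    intro j _
    rw [if_neg (by omega)]

theorem map_sum_left {U V W X : Type} [AddCommMonoid U] [Module ℂ U] [AddCommMonoid V] [Module ℂ V]
    [AddCommMonoid W] [Module ℂ W] [AddCommMonoid X] [Module ℂ X] (s : Finset ℕ)
    (f : ℕ → (U →ₗ[ℂ] V)) (g : W →ₗ[ℂ] X) :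
    TensorProduct.map (∑ k ∈ s, f k) g = ∑ k ∈ s, TensorProduct.map (f k) g :=
  TensorProduct.ext' fun x y => by simp [TensorProduct.sum_tmul]

/-- Both ways of moving the second factor past the others, before the phases are compared. -/
theorem sum_q6j_eq (hq : NotRootOfUnity h) {l₁ l₂ l₃ l₄ l₂₃ l₂₄ l₁₂₃ l₁₂₄ l₁₂₃₄ : ℂ}
    (g₁ : IsGeneric h l₁) (g₂ : IsGeneric h l₂) (g₃ : IsGeneric h l₃) (g₄ : IsGeneric h l₄)
    (g₁₂ : IsGeneric h (l₁ + l₂)) (g₂₃ : IsGeneric h l₂₃) (g₂₄ : IsGeneric h l₂₄)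
    (g₁₂₃ : IsGeneric h l₁₂₃) (g₁₂₄ : IsGeneric h l₁₂₄) (g₂₃₄ : IsGeneric h (l₂ + l₃ + l₄))
    (g₁₂₃₄ : IsGeneric h l₁₂₃₄) (a₂₃ : Adm l₂ l₃ l₂₃) (a₂₄ : Adm l₂ l₄ l₂₄)
    (a₁₂₃ : Adm l₁ l₂₃ l₁₂₃) (a₁₂₄ : Adm l₁ l₂₄ l₁₂₄) (b₁₂₃₄ : Adm l₄ l₁₂₃ l₁₂₃₄)
    (c₁₂₃₄ : Adm l₃ l₁₂₄ l₁₂₃₄) {n₁₂₃ n₁₂₄ n₁₂₃₄ : ℕ} (h₁₂₃ : l₁ + l₂ + l₃ - l₁₂₃ = n₁₂₃)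
    (h₁₂₄ : l₁ + l₂ + l₄ - l₁₂₄ = n₁₂₄) (h₁₂₃₄ : l₁ + l₂ + l₃ + l₄ - l₁₂₃₄ = n₁₂₃₄) :
    ∑ j ∈ Finset.range (n₁₂₄ + 1), q6j h l₄ l₂ l₂₄ l₁ l₁₂₄ (l₁ + l₂ - j) *
        braidPhase h l₂ l₁ (l₁ + l₂ - j) * (if j ≤ n₁₂₃ then
          q6j h l₁ l₂ (l₁ + l₂ - j) l₃ l₁₂₃ l₂₃ *
            q6j h l₄ (l₁ + l₂ - j) l₁₂₄ l₃ l₁₂₃₄ l₁₂₃ else 0) =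
      braidPhase h l₂₄ l₁ l₁₂₄ * ∑ k ∈ Finset.range (n₁₂₃₄ + 1),
        q6j h l₁ l₂₄ l₁₂₄ l₃ l₁₂₃₄ (l₂ + l₃ + l₄ - k) *
          (q6j h l₄ l₂ l₂₄ l₃ (l₂ + l₃ + l₄ - k) l₂₃ *
            q6j h l₄ l₂₃ (l₂ + l₃ + l₄ - k) l₁ l₁₂₃₄ l₁₂₃ * braidPhase h l₂₃ l₁ l₁₂₃ /
              braidPhase h (l₂ + l₃ + l₄ - k) l₁ l₁₂₃₄) := by
  have adm_comm : ∀ {x y z : ℂ}, Adm x y z → Adm y x z := fun ⟨n, hn⟩ =>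
    ⟨n, by rw [← hn]; ring⟩
  obtain ⟨u, hu⟩ := id a₂₃
  obtain ⟨t, ht⟩ := id a₁₂₃
  obtain ⟨v, hv⟩ := id a₂₄
  obtain ⟨w, hw⟩ := id c₁₂₃₄
  obtain ⟨w', hw'⟩ := id a₁₂₄
  have hu' : l₂₃ = l₂ + l₃ - u := by linear_combination -hu
  have ht' : l₁₂₃ = l₁ + l₂₃ - t := by linear_combination -ht
  have g₂₃' : IsGeneric h (l₂ + l₃) := g₂₃.of_sub_natCast hu
  have g₁₂₃' : IsGeneric h (l₁ + l₂₃) := g₁₂₃.of_sub_natCast ht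
  have g₂₄₃ : IsGeneric h (l₂₄ + l₃) := by
    have := g₂₃₄.sub_natCast v
    rwa [show l₂ + l₃ + l₄ - v = l₂₄ + l₃ by linear_combination hv] at this
  obtain ⟨C, hC⟩ := exists_braid_leftInverse h l₄ l₁
  obtain ⟨π, hπ⟩ := exists_isProj hq g₂ g₃ g₂₃'
  obtain ⟨π', hπ'⟩ := exists_isProj hq g₁ g₂₃ g₁₂₃'
  obtain ⟨x, hx⟩ := id b₁₂₃₄
  -- A nonzero coordinate of the final embedding allows scalar multiples of it to be compared.
  have hne : coord x 0 (emb h l₄ l₁₂₃ l₁₂₃₄ (vec 0)) ≠ 0 := by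
    rw [emb_vec_zero, coord_hwVec h hx, if_pos (add_zero x)]
    exact mul_ne_zero (Delta_ne_zero hq g₄ g₁₂₃ g₁₂₃₄) (hwCoeff_ne_zero hq g₄ g₁₂₃ x 0)
  have hcancel : ∀ p r : ℂ, p • emb h l₄ l₁₂₃ l₁₂₃₄ = r • emb h l₄ l₁₂₃ l₁₂₃₄ → p = r :=
    fun p r e => by
      have := congrArg (fun f => coord x 0 (f (vec 0))) e
      simp only [LinearMap.smul_apply, map_smul, smul_eq_mul] at this
      exact mul_right_cancel₀ hne this
  refine hcancel _ _ ?_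
  set G := (TensorProduct.map LinearMap.id (π' t ∘ₗ TensorProduct.map LinearMap.id (π u)) :
    Verma ⊗[ℂ] (Verma ⊗[ℂ] (Verma ⊗[ℂ] Verma)) →ₗ[ℂ] Verma ⊗[ℂ] Verma) with hG
  -- First evaluation: the braiding is undone inside 124, before the third factor is recoupled.
  have hl : ∑ j ∈ Finset.range (n₁₂₄ + 1), (q6j h l₄ l₂ l₂₄ l₁ l₁₂₄ (l₁ + l₂ - j) *
      braidPhase h l₂ l₁ (l₁ + l₂ - j)) • (G ∘ₗ reassoc ∘ₗ
        TensorProduct.map (rightEmb h l₄ l₁ l₂ l₁₂₄ (l₁ + l₂ - j)) LinearMap.id ∘ₗ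
          emb h l₁₂₄ l₃ l₁₂₃₄) =
      braidPhase h l₂₄ l₁ l₁₂₄ • (G ∘ₗ reassoc ∘ₗ TensorProduct.map (onLeft C Verma ∘ₗ
        TensorProduct.map LinearMap.id (emb h l₄ l₂ l₂₄) ∘ₗ emb h l₁ l₂₄ l₁₂₄) LinearMap.id ∘ₗ
          emb h l₁₂₄ l₃ l₁₂₃₄) := by
    have key := sum_q6j_braidPhase hq g₄ g₂ g₂₄ g₁ (by rwa [add_comm]) g₁₂₄ (adm_comm a₂₄)
      (adm_comm a₁₂₄) (n := n₁₂₄) (by rw [← h₁₂₄]; ring) hC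
    rw [add_comm l₂ l₁] at key
    have := congrArg (fun f => G ∘ₗ reassoc ∘ₗ
      TensorProduct.map f (LinearMap.id : Verma →ₗ[ℂ] Verma) ∘ₗ emb h l₁₂₄ l₃ l₁₂₃₄) key
    simp only [map_sum_left, TensorProduct.map_smul_left, LinearMap.smul_comp,
      LinearMap.comp_smul, linearMap_sum_comp, linearMap_comp_sum] at this
    exact this
  -- Second evaluation: the third factor is recoupled with 24 first, and `C` acts afterwards.
  have hr : G ∘ₗ reassoc ∘ₗ TensorProduct.map (onLeft C Verma ∘ₗ
        TensorProduct.map LinearMap.id (emb h l₄ l₂ l₂₄) ∘ₗ emb h l₁ l₂₄ l₁₂₄) LinearMap.id ∘ₗ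
          emb h l₁₂₄ l₃ l₁₂₃₄ =
      ∑ k ∈ Finset.range (w + w' + 1), q6j h l₁ l₂₄ l₁₂₄ l₃ l₁₂₃₄ (l₂₄ + l₃ - k) •
        (G ∘ₗ onLeft C (Verma ⊗[ℂ] Verma) ∘ₗ
          TensorProduct.map LinearMap.id (leftEmb h l₄ l₂ l₂₄ l₃ (l₂₄ + l₃ - k)) ∘ₗ
            emb h l₁ (l₂₄ + l₃ - k) l₁₂₃₄) := by
    have e1 : TensorProduct.map (onLeft C Verma ∘ₗ
        TensorProduct.map LinearMap.id (emb h l₄ l₂ l₂₄) ∘ₗ emb h l₁ l₂₄ l₁₂₄) LinearMap.id =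
        TensorProduct.map (onLeft C Verma ∘ₗ TensorProduct.map LinearMap.id (emb h l₄ l₂ l₂₄))
          LinearMap.id ∘ₗ TensorProduct.map (emb h l₁ l₂₄ l₁₂₄)
            (LinearMap.id : Verma →ₗ[ℂ] Verma) := by
      rw [← TensorProduct.map_comp, LinearMap.id_comp, LinearMap.comp_assoc]
    have e2 := leftEmb_eq_sum hq g₁ g₂₄ g₃ g₁₂₄ g₂₄₃ g₁₂₃₄ a₁₂₄ (adm_comm c₁₂₃₄)
      (n := w + w') (by push_cast; linear_combination hw + hw')
    rw [leftEmb] at e2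
    rw [e1, LinearMap.comp_assoc, ← LinearMap.comp_assoc _ _ reassoc, ← onLeft_reassoc,
      LinearMap.comp_assoc, LinearMap.comp_assoc, e2]
    simp only [linearMap_comp_sum, LinearMap.comp_smul]
    refine Finset.sum_congr rfl fun k _ => ?_
    rw [rightEmb, ← LinearMap.comp_assoc (emb h l₁ (l₂₄ + l₃ - k) l₁₂₃₄), ← lTensor_comp]
    rfl
  have hl' : ∀ j : ℕ, j ∈ Finset.range (n₁₂₄ + 1) → G ∘ₗ reassoc ∘ₗ
      TensorProduct.map (rightEmb h l₄ l₁ l₂ l₁₂₄ (l₁ + l₂ - j)) LinearMap.id ∘ₗ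
        emb h l₁₂₄ l₃ l₁₂₃₄ = _ := fun j hj =>
    extract_unmoved hq g₄ g₂ g₁ g₃ g₂₃' (g₁₂.sub_natCast j) g₁₂₄ g₁₂₃ g₁₂₃₄ (adm_sub l₁ l₂ j)
      ⟨n₁₂₄ - j, by
        rw [Nat.cast_sub (by have := Finset.mem_range.mp hj; omega), ← h₁₂₄]
        ring⟩ (adm_comm c₁₂₃₄) b₁₂₃₄ hπ hπ' hu' ht' h₁₂₃ rfl
  have hr' : ∀ k : ℕ, k ∈ Finset.range (w + w' + 1) → G ∘ₗ onLeft C (Verma ⊗[ℂ] Verma) ∘ₗ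
      TensorProduct.map LinearMap.id (leftEmb h l₄ l₂ l₂₄ l₃ (l₂₄ + l₃ - k)) ∘ₗ
        emb h l₁ (l₂₄ + l₃ - k) l₁₂₃₄ = _ := fun k hk =>
    extract_moved hq g₄ g₂ g₁ g₃ g₂₄ g₂₃' g₂₃ g₁₂₃' (g₂₄₃.sub_natCast k) g₁₂₃₄ (adm_comm a₂₄)
      (adm_sub l₂₄ l₃ k) ⟨w + w' - k, by
        rw [Nat.cast_sub (by have := Finset.mem_range.mp hk; omega)]
        push_cast
        linear_combination hw + hw'⟩ b₁₂₃₄ hC hπ hπ' hu' ht'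
  rw [Finset.sum_congr rfl fun k hk => by rw [hr' k hk]] at hr
  rw [hr, Finset.sum_congr rfl fun j hj => by rw [hl' j hj]] at hl
  simp only [smul_smul, ← Finset.sum_smul] at hl
  rw [hl]
  congr 2
  -- Counting β down from l₂ + l₃ + l₄ instead of l₂₄ + l₃ shifts the index by v. The first v terms
  -- vanish since (l₂₄, l₃, β) is not admissible there.
  have hn : n₁₂₃₄ = v + (w + w') := by
    have : (n₁₂₃₄ : ℂ) = (v + (w + w') : ℕ) := by
      push_cast
      linear_combination hv + hw + hw' - h₁₂₃₄
    exact_mod_cast this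
  symm
  rw [hn, add_assoc v, Finset.sum_range_add _ v, Finset.sum_eq_zero, zero_add]
  · refine Finset.sum_congr rfl fun k _ => ?_
    rw [show l₂ + l₃ + l₄ - ((v + k : ℕ) : ℂ) = l₂₄ + l₃ - k by
      push_cast; linear_combination hv]
  · intro k hk
    rw [q6j, dif_neg, zero_mul]
    rintro ⟨⟨-, -, ⟨y, hy⟩, -⟩, -⟩
    have : (k : ℂ) = (v + y : ℕ) := by push_cast; linear_combination hy + hv
    have : k = v + y := by exact_mod_cast this
    rw [Finset.mem_range] at hk
    omega

theorem sum_range_min (n m : ℕ) (f : ℕ → ℂ) :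
    ∑ j ∈ Finset.range (min n m + 1), f j =
      ∑ j ∈ Finset.range (m + 1), if j ≤ n then f j else 0 := by
  rw [← Finset.sum_filter]
  refine Finset.sum_congr (Finset.ext fun j => ?_) fun _ _ => rfl
  simp only [Finset.mem_range, Finset.mem_filter]
  omega

/-- The factor in front of `braidPhase` does not involve the summation variable y, and it is the
same as in `braidPhase_eq_div`. -/
theorem braidPhase_eq_mul (h a b c x y : ℂ) :
    (-1 : ℂ) ^ (x - a - y - b) * qpow h (x * (x + 1) - a * (a + 1) - y * (y + 1) - b * (b + 1)) =
      (-1) ^ (-c - a - b) * qpow h (-(c * (c + 1)) - a * (a + 1) - b * (b + 1)) *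
        braidPhase h x c y := by
  have hne : (-1 : ℂ) ≠ 0 := by norm_num
  rw [braidPhase, mul_mul_mul_comm, ← Complex.cpow_add _ _ hne, ← qpow_add]
  congr 2 <;> ring

theorem braidPhase_eq_div (h l a b a' b' c y : ℂ) :
    (-1 : ℂ) ^ (l - a' - y - b') *
        qpow h (l * (l + 1) - a' * (a' + 1) - y * (y + 1) - b' * (b' + 1)) =
      (-1) ^ (-c - a - b) * qpow h (-(c * (c + 1)) - a * (a + 1) - b * (b + 1)) *
        (braidPhase h b c b' * braidPhase h a c a' / braidPhase h y c l) := by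
  have hne : (-1 : ℂ) ≠ 0 := by norm_num
  rw [← mul_div_assoc, eq_div_iff (braidPhase_ne_zero h y c l), braidPhase, braidPhase, braidPhase]
  rw [mul_mul_mul_comm, ← Complex.cpow_add _ _ hne, ← qpow_add, mul_mul_mul_comm (_ ^ (b + c - b')),
    ← Complex.cpow_add _ _ hne, ← qpow_add, mul_mul_mul_comm, ← Complex.cpow_add _ _ hne,
    ← qpow_add]
  congr 2 <;> ring

end Extraction

end VermaRacah

end

theorem mainTheorem5 (h : ℂ) (hq : VermaRacah.NotRootOfUnity h)
    (l₁ l₂ l₃ l₄ l₂₃ l₂₄ l₁₂₃ l₁₂₄ l₁₂₃₄ : ℂ)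
    (g₁ : VermaRacah.IsGeneric h l₁) (g₂ : VermaRacah.IsGeneric h l₂)
    (g₃ : VermaRacah.IsGeneric h l₃) (g₄ : VermaRacah.IsGeneric h l₄)
    (g₁₂ : VermaRacah.IsGeneric h (l₁ + l₂))
    (g₂₃ : VermaRacah.IsGeneric h l₂₃) (g₂₄ : VermaRacah.IsGeneric h l₂₄)
    (g₁₂₃ : VermaRacah.IsGeneric h l₁₂₃) (g₁₂₄ : VermaRacah.IsGeneric h l₁₂₄)
    (g₂₃₄ : VermaRacah.IsGeneric h (l₂ + l₃ + l₄))
    (g₁₂₃₄ : VermaRacah.IsGeneric h l₁₂₃₄)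
    (a₂₃ : VermaRacah.Adm l₂ l₃ l₂₃) (a₂₄ : VermaRacah.Adm l₂ l₄ l₂₄)
    (a₁₂₃ : VermaRacah.Adm l₁ l₂₃ l₁₂₃) (a₁₂₄ : VermaRacah.Adm l₁ l₂₄ l₁₂₄)
    (b₁₂₃₄ : VermaRacah.Adm l₄ l₁₂₃ l₁₂₃₄) (c₁₂₃₄ : VermaRacah.Adm l₃ l₁₂₄ l₁₂₃₄)
    (n₁₂₃ n₁₂₄ n₁₂₃₄ : ℕ)
    (h₁₂₃ : l₁ + l₂ + l₃ - l₁₂₃ = n₁₂₃) (h₁₂₄ : l₁ + l₂ + l₄ - l₁₂₄ = n₁₂₄)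
    (h₁₂₃₄ : l₁ + l₂ + l₃ + l₄ - l₁₂₃₄ = n₁₂₃₄) :
    ∑ j ∈ Finset.range (min n₁₂₃ n₁₂₄ + 1), (fun α : ℂ =>
        (-1 : ℂ) ^ (l₂ - l₂₃ - α - l₂₄) *
        VermaRacah.qpow h
          (l₂ * (l₂ + 1) - l₂₃ * (l₂₃ + 1) - α * (α + 1) - l₂₄ * (l₂₄ + 1)) *
        (VermaRacah.q6j h l₁ l₂ α l₃ l₁₂₃ l₂₃ *
          VermaRacah.q6j h l₄ α l₁₂₄ l₃ l₁₂₃₄ l₁₂₃ *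
          VermaRacah.q6j h l₄ l₂ l₂₄ l₁ l₁₂₄ α)) (l₁ + l₂ - j) =
      ∑ k ∈ Finset.range (n₁₂₃₄ + 1), (fun β : ℂ =>
        (-1 : ℂ) ^ (l₁₂₃₄ - l₁₂₃ - β - l₁₂₄) *
        VermaRacah.qpow h
          (l₁₂₃₄ * (l₁₂₃₄ + 1) - l₁₂₃ * (l₁₂₃ + 1) - β * (β + 1) - l₁₂₄ * (l₁₂₄ + 1)) *
        (VermaRacah.q6j h l₄ l₂₃ β l₁ l₁₂₃₄ l₁₂₃ *
          VermaRacah.q6j h l₄ l₂ l₂₄ l₃ β l₂₃ *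
          VermaRacah.q6j h l₁ l₂₄ l₁₂₄ l₃ l₁₂₃₄ β)) (l₂ + l₃ + l₄ - k) := by
  beta_reduce
  have key := VermaRacah.sum_q6j_eq hq g₁ g₂ g₃ g₄ g₁₂ g₂₃ g₂₄ g₁₂₃ g₁₂₄ g₂₃₄ g₁₂₃₄ a₂₃ a₂₄ a₁₂₃
    a₁₂₄ b₁₂₃₄ c₁₂₃₄ h₁₂₃ h₁₂₄ h₁₂₃₄
  rw [VermaRacah.sum_range_min]
  -- Multiplying by this factor, common to the two phase lemmas, completes the phases on both sides.
  have e := congrArg ((-1 : ℂ) ^ (-l₁ - l₂₃ - l₂₄) * VermaRacah.qpow h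
    (-(l₁ * (l₁ + 1)) - l₂₃ * (l₂₃ + 1) - l₂₄ * (l₂₄ + 1)) * ·) key
  simp only [Finset.mul_sum] at e
  convert e using 1
  · refine Finset.sum_congr rfl fun j _ => ?_
    split_ifs
    · rw [VermaRacah.braidPhase_eq_mul h l₂₃ l₂₄ l₁]
      ring
    · rw [mul_zero, mul_zero]
  · refine Finset.sum_congr rfl fun k _ => ?_
    rw [VermaRacah.braidPhase_eq_div h l₁₂₃₄ l₂₃ l₂₄ l₁₂₃ l₁₂₄ l₁]
    ring
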